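/- **Setting.** All Hilbert spaces are finite-dimensional; a quantum channel is a completely positive trace-preserving linear map, and $\|\mathcal N-\mathcal M\|_\diamond=\sup_d\max_\rho\|(\mathrm{id}_d\otimes\mathcal N)(\rho)-(\mathrm{id}_d\otimes\mathcal M)(\rho)\|_1$, with $\rho$ ranging over the states of a $d$-dimensional ancilla and the input. A $d$-dimensional system is said to consist of $\lceil\log_2 d\rceil$ qubits. Fix $n\ge 0$, a function $f:\{0,1\}^n\times\{0,1\}^n\to\{0,1\}$, and a Hilbert space $\mathcal H_Q$ of dimension $d_Q\geq 1$. Alice and Bob share a resource state $\rho_{LR}$ that does not depend on the inputs. *CDQS (conditional disclosure of quantum secrets).* On input $x$, Alice applies a channel $\mathcal N^x_{QL\to M_0}$; on input $y$, Bob applies a channel $\mathcal N^y_{R\to M_1}$; the messages $M=M_0M_1$ go to the referee. Let $\mathcal N^{x,y}_{Q\to M}$ be the resulting channel. The protocol is $\epsilon$-correct if for all $(x,y)$ with $f(x,y)=1$ there is a channel $\mathcal D^{x,y}_{M\to Q}$ with $\|\mathcal D^{x,y}\circ\mathcal N^{x,y}-\mathcal I_Q\|_\diamond\le\epsilon$.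 It is $\delta$-secure if for all $(x,y)$ with $f(x,y)=0$ there is a state $\sigma^{x,y}_M$ with $\|\sigma^{x,y}_M\operatorname{tr}_Q(\cdot)-\mathcal N^{x,y}\|_\diamond\le\delta$. *$f$-routing.* On input $x$, Alice applies a channel $\mathcal N^x_{QL\to M_0M_0'}$, sends $M_0$ to Bob and keeps $M_0'$; on input $y$, Bob applies a channel $\mathcal N^y_{R\to M_1M_1'}$, keeps $M_1$ and sends $M_1'$ to Alice. Put $M=M_0M_1$ (held by Bob after the exchange) and $M'=M_0'M_1'$ (held by Alice), and let $\mathcal N^{x,y}_{Q\to MM'}$ be the resulting channel. The protocol is $\epsilon$-correct if for all $(x,y)$ with $f(x,y)=1$ there is a channel $\mathcal D^{x,y}_{M\to Q}$ with $\|\mathcal D^{x,y}\circ\operatorname{tr}_{M'}\circ\,\mathcal N^{x,y}-\mathcal I_Q\|_\diamond\le\epsilon$, and for all $(x,y)$ with $f(x,y)=0$ there is a channel $\mathcal D^{x,y}_{M'\to Q}$ with $\|\mathcal D^{x,y}\circ\operatorname{tr}_{M}\circ\,\mathcal N^{x,y}-\mathcal I_Q\|_\diamond\le\epsilon$. **Theorem.**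 Let $\epsilon,\delta\ge 0$. 1. If there is an $\epsilon$-correct $f$-routing protocol for $f$ and $Q$, then there is a CDQS protocol for $f$ and $Q$ that is $\epsilon$-correct and $2\sqrt{\epsilon}$-secure, uses the same resource state, and has messages $M_0$, $M_1$ of the same dimensions as the systems $M_0$, $M_1$ of the $f$-routing protocol. 2. Suppose there is an $\epsilon$-correct and $\delta$-secure CDQS protocol for $f$ and $Q$ with a pure resource state on a system $LR$ of at most $n_E$ qubits and with messages $M_0$, $M_1$ of at most $n_M$ qubits each. Then there is a $\max\{\epsilon,2\sqrt{\delta}\}$-correct $f$-routing protocol for $f$ and $Q$ that uses the same resource state and in which the exchanged systems $M_0$, $M_1'$ together consist of at most $4(n_M+n_E)$ qubits; moreover all four systems $M_0,M_0',M_1,M_1'$, kept ones included, together consist of at most $4(n_M+n_E)+\lceil\log_2 d_Q\rceil$ qubits. -/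

import Mathlib

open scoped ComplexOrder Kronecker

namespace QuantumRouting

noncomputable section

/-- Operators on the finite-dimensional Hilbert space with orthonormal basis indexed by `A`.
The tensor product of two systems is indexed by the product of the index types. -/
abbrev Op (A : Type*) := Matrix A A ℂ

/-- Linear maps between operator spaces. -/
abbrev SuperOp (A B : Type*) := Op A →ₗ[ℂ] Op B

/-- Density operators. -/
structure IsDensity {A : Type*} [Fintype A] (ρ : Op A) : Prop where
  posSemidef : ρ.PosSemidef
  trace_eq_one : ρ.trace = 1

/-- `ρ` is the pure state `|ψ⟩⟨ψ|` of some vector `ψ`. -/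
def IsPure {A : Type*} (ρ : Op A) : Prop :=
  ∃ ψ : A → ℂ, ρ = Matrix.vecMulVec ψ (star ψ)

/-- `id_R ⊗ Φ`, acting blockwise on operators of the system `R ⊗ A`. -/
def onRight (R : Type*) {A B : Type*} (Φ : SuperOp A B) : SuperOp (R × A) (R × B) where
  toFun X := Matrix.of fun p q =>
    Φ (Matrix.of fun a a' => X (p.1, a) (q.1, a')) p.2 q.2
  map_add' X Y := by
    ext p q
    exact congrFun (congrFun (map_add Φ (Matrix.of fun a a' => X (p.1, a) (q.1, a'))
      (Matrix.of fun a a' => Y (p.1, a) (q.1, a'))) p.2) q.2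
  map_smul' c X := by
    ext p q
    exact congrFun (congrFun (map_smul Φ c (Matrix.of fun a a' => X (p.1, a) (q.1, a'))) p.2) q.2

/-- `Φ ⊗ id_R`, acting blockwise on operators of the system `A ⊗ R`. -/
def onLeft (R : Type*) {A B : Type*} (Φ : SuperOp A B) : SuperOp (A × R) (B × R) where
  toFun X := Matrix.of fun p q =>
    Φ (Matrix.of fun a a' => X (a, p.2) (a', q.2)) p.1 q.1
  map_add' X Y := by
    ext p q
    exact congrFun (congrFun (map_add Φ (Matrix.of fun a a' => X (a, p.2) (a', q.2))
      (Matrix.of fun a a' => Y (a, p.2) (a', q.2))) p.1) q.1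
  map_smul' c X := by
    ext p q
    exact congrFun (congrFun (map_smul Φ c (Matrix.of fun a a' => X (a, p.2) (a', q.2))) p.1) q.1

/-- The tensor product `Φ ⊗ Ψ = (Φ ⊗ id) ∘ (id ⊗ Ψ)`. -/
def tensorMap {A B C D : Type*} (Φ : SuperOp A C) (Ψ : SuperOp B D) :
    SuperOp (A × B) (C × D) :=
  onLeft D Φ ∘ₗ onRight A Ψ

/-- Quantum channels: completely positive trace-preserving linear maps. -/
structure IsChannel {A B : Type*} [Fintype A] [Fintype B] (Φ : SuperOp A B) : Prop where
  completelyPositive : ∀ (k : ℕ) (X : Op (Fin k × A)),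
    X.PosSemidef → (onRight (Fin k) Φ X).PosSemidef
  tracePreserving : ∀ X : Op A, (Φ X).trace = X.trace

/-- The trace norm `‖X‖₁ = tr √(X† X)`, the sum of the square roots of the eigenvalues
of `X† X`. -/
def traceNorm {A : Type*} [Fintype A] [DecidableEq A] (X : Op A) : ℝ :=
  ∑ i, Real.sqrt ((Matrix.isHermitian_conjTranspose_mul_self X).eigenvalues i)

/-- The diamond norm distance: the supremum over all ancilla dimensions `d` and all states `ρ`
of the ancilla and the input of the trace norm distance of the two outputs. (An extended real,
so that no boundedness is needed for the supremum to make sense; on channels it is finite.) -/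
def diamondDist {A B : Type*} [Fintype A] [Fintype B] [DecidableEq B]
    (Φ Ψ : SuperOp A B) : EReal :=
  ⨆ (d : ℕ) (ρ : Op (Fin d × A)) (_ : IsDensity ρ),
    ((traceNorm (onRight (Fin d) Φ ρ - onRight (Fin d) Ψ ρ) : ℝ) : EReal)

/-- The partial trace over the second tensor factor. -/
def traceRight {A B : Type*} [Fintype B] : SuperOp (A × B) A where
  toFun X := Matrix.of fun a a' => ∑ b, X (a, b) (a', b)
  map_add' X Y := by ext a a'; simp [Finset.sum_add_distrib]
  map_smul' c X := by ext a a'; simp [Finset.mul_sum]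

/-- The partial trace over the first tensor factor. -/
def traceLeft {A B : Type*} [Fintype A] : SuperOp (A × B) B where
  toFun X := Matrix.of fun b b' => ∑ a, X (a, b) (a, b')
  map_add' X Y := by ext b b'; simp [Finset.sum_add_distrib]
  map_smul' c X := by ext b b'; simp [Finset.mul_sum]

/-- Discard the input and prepare `σ`: the map `X ↦ tr(X) σ`. -/
def discardPrepare {A B : Type*} [Fintype A] (σ : Op B) : SuperOp A B where
  toFun X := X.trace • σ
  map_add' X Y := by rw [Matrix.trace_add, add_smul]
  map_smul' c X := by simp [Matrix.trace_smul, mul_smul]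

/-- Append the state `ρ` of `L ⊗ R` to the input on `Q`, bracketed as `(Q ⊗ L) ⊗ R`. -/
def attach {Q L R : Type*} (ρ : Op (L × R)) : SuperOp Q ((Q × L) × R) where
  toFun X := Matrix.of fun p q => X p.1.1 q.1.1 * ρ (p.1.2, p.2) (q.1.2, q.2)
  map_add' X Y := by ext p q; simp [add_mul]
  map_smul' c X := by ext p q; simp [mul_assoc]

/-- A bipartite resource state, one share `L` held by Alice and the other, `R`, by Bob. -/
structure Resource where
  dL : ℕ
  dR : ℕ
  state : Op (Fin dL × Fin dR)
  isDensity : IsDensity state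

/-- The number of qubits needed to hold a `d`-dimensional system: the least `k` with
`d ≤ 2 ^ k`. -/
def qubits (d : ℕ) : ℕ := Nat.clog 2 d

/-- The number of qubits of the resource system `L R`. -/
def Resource.size (S : Resource) : ℕ := qubits (S.dL * S.dR)

/-- A CDQS protocol, for inputs `x, y` of `n` bits and a secret of dimension `dQ`. On input `x`
Alice maps `Q` and her share `L` of the resource to her message `M₀`; on input `y` Bob maps his
share `R` to his message `M₁`. Both messages go to the referee. -/
structure CDQSProtocol (n dQ : ℕ) where
  resource : Resource
  dM0 : ℕ
  dM1 : ℕ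
  alice : (Fin n → Bool) → SuperOp (Fin dQ × Fin resource.dL) (Fin dM0)
  bob : (Fin n → Bool) → SuperOp (Fin resource.dR) (Fin dM1)
  alice_isChannel : ∀ x, IsChannel (alice x)
  bob_isChannel : ∀ y, IsChannel (bob y)

namespace CDQSProtocol

variable {n dQ : ℕ} (P : CDQSProtocol n dQ)

/-- The channel from `Q` to `M = M₀ M₁` realized by Alice and Bob's combined actions. -/
def action (x y : Fin n → Bool) : SuperOp (Fin dQ) (Fin P.dM0 × Fin P.dM1) :=
  tensorMap (P.alice x) (P.bob y) ∘ₗ attach P.resource.state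

/-- On every 1-instance some decoder recovers `Q` from `M` up to `ε` in diamond norm. -/
def IsCorrect (f : (Fin n → Bool) → (Fin n → Bool) → Bool) (ε : ℝ) : Prop :=
  ∀ x y, f x y = true → ∃ D : SuperOp (Fin P.dM0 × Fin P.dM1) (Fin dQ), IsChannel D ∧
    diamondDist (D ∘ₗ P.action x y) LinearMap.id ≤ (ε : EReal)

/-- On every 0-instance a simulator, preparing a state of `M` without access to `Q`, imitates
the channel from `Q` to `M` up to `δ` in diamond norm. -/
def IsSecure (f : (Fin n → Bool) → (Fin n → Bool) → Bool) (δ : ℝ) : Prop :=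
  ∀ x y, f x y = false → ∃ σ : Op (Fin P.dM0 × Fin P.dM1), IsDensity σ ∧
    diamondDist (discardPrepare σ) (P.action x y) ≤ (δ : EReal)

end CDQSProtocol

/-- The first round of an `f`-routing protocol, for inputs `x, y` of `n` bits and a system `Q`
of dimension `dQ`. On input `x` Alice maps `Q` and her share `L` of the resource to `M₀`, which
she sends to Bob, and `M₀'`, which she keeps; on input `y` Bob maps his share `R` to `M₁`, which
he keeps, and `M₁'`, which he sends to Alice. -/
structure RoutingProtocol (n dQ : ℕ) where
  resource : Resource
  dM0 : ℕ
  dM0' : ℕ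
  dM1 : ℕ
  dM1' : ℕ
  alice : (Fin n → Bool) → SuperOp (Fin dQ × Fin resource.dL) (Fin dM0 × Fin dM0')
  bob : (Fin n → Bool) → SuperOp (Fin resource.dR) (Fin dM1 × Fin dM1')
  alice_isChannel : ∀ x, IsChannel (alice x)
  bob_isChannel : ∀ y, IsChannel (bob y)

namespace RoutingProtocol

variable {n dQ : ℕ} (P : RoutingProtocol n dQ)

/-- The channel from `Q` to `M M'` realized by the first round, where `M = M₀ M₁` is with Bob
and `M' = M₀' M₁'` is with Alice after the exchange. -/
def action (x y : Fin n → Bool) :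
    SuperOp (Fin dQ) ((Fin P.dM0 × Fin P.dM1) × (Fin P.dM0' × Fin P.dM1')) :=
  (Matrix.reindexLinearEquiv ℂ ℂ
      (Equiv.prodProdProdComm (Fin P.dM0) (Fin P.dM0') (Fin P.dM1) (Fin P.dM1'))
      (Equiv.prodProdProdComm (Fin P.dM0) (Fin P.dM0') (Fin P.dM1) (Fin P.dM1'))).toLinearMap
    ∘ₗ tensorMap (P.alice x) (P.bob y) ∘ₗ attach P.resource.state

/-- On every 1-instance Bob can recover `Q` from `M`, and on every 0-instance Alice can recover
`Q` from `M'`, up to `ε` in diamond norm. -/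
def IsCorrect (f : (Fin n → Bool) → (Fin n → Bool) → Bool) (ε : ℝ) : Prop :=
  (∀ x y, f x y = true → ∃ D : SuperOp (Fin P.dM0 × Fin P.dM1) (Fin dQ), IsChannel D ∧
    diamondDist (D ∘ₗ traceRight ∘ₗ P.action x y) LinearMap.id ≤ (ε : EReal)) ∧
  (∀ x y, f x y = false → ∃ D : SuperOp (Fin P.dM0' × Fin P.dM1') (Fin dQ), IsChannel D ∧
    diamondDist (D ∘ₗ traceLeft ∘ₗ P.action x y) LinearMap.id ≤ (ε : EReal))

/-- The number of qubits of message exchanged, `M₀` from Alice to Bob and `M₁'` from Bob to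
Alice. -/
def exchangedQubits : ℕ := qubits P.dM0 + qubits P.dM1'

/-- The number of qubits of all four systems put out by the first round, kept or sent. -/
def totalQubits : ℕ := qubits P.dM0 + qubits P.dM0' + qubits P.dM1 + qubits P.dM1'

end RoutingProtocol

end

end QuantumRouting

namespace QuantumRouting

open Matrix

set_option linter.unusedSectionVars false

/-! ### Contractions, trace norm duality, and the fidelity inequality. -/

section TraceNorm

variable {l m n : Type*} [Fintype l] [Fintype m] [Fintype n]
  [DecidableEq l] [DecidableEq m] [DecidableEq n]

/-- `C` is a contraction: `C† C ≤ 1`. -/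
def IsContraction (C : Matrix m n ℂ) : Prop := (1 - Cᴴ * C).PosSemidef

-- The C*-identity translates the order condition into the operator norm, from which closure under
-- adjoints and products, compactness and convexity follow.
open scoped Matrix.Norms.L2Operator MatrixOrder in
lemma isContraction_iff_norm_le_one (C : Matrix m n ℂ) : IsContraction C ↔ ‖C‖ ≤ 1 := by
  have h0 : (0 : Matrix n n ℂ) ≤ Cᴴ * C :=
    Matrix.nonneg_iff_posSemidef.2 (posSemidef_conjTranspose_mul_self C)
  rw [IsContraction, ← Matrix.le_iff, ← CStarAlgebra.norm_le_one_iff_of_nonneg _ h0,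
    l2_opNorm_conjTranspose_mul_self, ← sq, sq_le_one_iff₀ (norm_nonneg _)]

lemma IsContraction.conjTranspose {C : Matrix m n ℂ} (hC : IsContraction C) :
    IsContraction Cᴴ := by
  rw [isContraction_iff_norm_le_one] at *
  rwa [l2_opNorm_conjTranspose]

lemma IsContraction.mul {A : Matrix l m ℂ} {B : Matrix m n ℂ} (hA : IsContraction A)
    (hB : IsContraction B) : IsContraction (A * B) := by
  rw [isContraction_iff_norm_le_one] at *
  exact (l2_opNorm_mul A B).trans (mul_le_one₀ hA (by rw [l2_opNorm_def]; exact norm_nonneg _) hB)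

lemma IsContraction.transpose {C : Matrix m n ℂ} (hC : IsContraction C) :
    IsContraction Cᵀ := by
  have h := (show (1 - Cᴴᴴ * Cᴴ).PosSemidef from hC.conjTranspose).transpose
  rw [IsContraction]
  rw [transpose_sub, transpose_one, transpose_mul, conjTranspose_conjTranspose] at h
  exact h

lemma re_trace_conjTranspose_mul_self (A : Matrix m n ℂ) :
    (Aᴴ * A).trace.re = ∑ i, ∑ j, ‖A j i‖ ^ 2 := by
  simp only [trace, diag_apply, mul_apply, conjTranspose_apply, Complex.re_sum, RCLike.star_def,
    Complex.conj_mul']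
  norm_cast

lemma re_trace_conjTranspose_mul_self_nonneg (A : Matrix m n ℂ) : 0 ≤ (Aᴴ * A).trace.re := by
  rw [re_trace_conjTranspose_mul_self]
  positivity

/-- The Cauchy-Schwarz inequality for the Hilbert-Schmidt inner product. -/
lemma norm_trace_conjTranspose_mul_le (A B : Matrix m n ℂ) :
    ‖(Aᴴ * B).trace‖ ≤ √(Aᴴ * A).trace.re * √(Bᴴ * B).trace.re := by
  simp only [re_trace_conjTranspose_mul_self]
  simp only [← Fintype.sum_prod_type' (f := fun i j => ‖A j i‖ ^ 2),
    ← Fintype.sum_prod_type' (f := fun i j => ‖B j i‖ ^ 2)]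
  refine le_trans ?_ (Real.sum_mul_le_sqrt_mul_sqrt Finset.univ (fun p : n × m => ‖A p.2 p.1‖)
    (fun p : n × m => ‖B p.2 p.1‖))
  rw [Fintype.sum_prod_type]
  simp only [trace, diag_apply, mul_apply, conjTranspose_apply]
  refine (norm_sum_le _ _).trans (Finset.sum_le_sum fun i _ => (norm_sum_le _ _).trans ?_)
  simp

lemma IsContraction.re_trace_le {H : Matrix l m ℂ} (hH : IsContraction H) (Y : Matrix m n ℂ) :
    ((H * Y)ᴴ * (H * Y)).trace.re ≤ (Yᴴ * Y).trace.re := by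
  have h := (PosSemidef.conjTranspose_mul_mul_same hH Y).trace_nonneg
  have e : Yᴴ * (1 - Hᴴ * H) * Y = Yᴴ * Y - (H * Y)ᴴ * (H * Y) := by
    simp only [conjTranspose_mul, Matrix.mul_sub, Matrix.sub_mul, Matrix.mul_one, Matrix.mul_assoc]
  rw [e, trace_sub] at h
  have := (Complex.le_def.1 h).1
  simpa using this

/-- Every positive semidefinite operator is a Gram operator. -/
lemma _root_.Matrix.PosSemidef.exists_conjTranspose_mul_self {S : Matrix n n ℂ}
    (hS : S.PosSemidef) : ∃ B : Matrix n n ℂ, S = Bᴴ * B := by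
  open scoped MatrixOrder in
  obtain ⟨B, hB⟩ := CStarAlgebra.nonneg_iff_eq_star_mul_self.1 (Matrix.nonneg_iff_posSemidef.2 hS)
  exact ⟨B, hB⟩

/-- With `S = B† B`, this is Cauchy-Schwarz for `B†` and `H B†`, since `H` does not increase the
Hilbert-Schmidt norm. -/
lemma IsContraction.norm_trace_mul_le {H S : Matrix n n ℂ} (hH : IsContraction H)
    (hS : S.PosSemidef) : ‖(H * S).trace‖ ≤ S.trace.re := by
  obtain ⟨B, rfl⟩ := hS.exists_conjTranspose_mul_self
  have e : (H * (Bᴴ * B)).trace = ((Bᴴ)ᴴ * (H * Bᴴ)).trace := by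
    rw [conjTranspose_conjTranspose, ← Matrix.mul_assoc, trace_mul_comm]
  rw [e]
  refine (norm_trace_conjTranspose_mul_le _ _).trans ?_
  have h1 := hH.re_trace_le Bᴴ
  have h2 : ((Bᴴ)ᴴ * Bᴴ).trace.re = (Bᴴ * B).trace.re := by
    rw [conjTranspose_conjTranspose, trace_mul_comm]
  rw [h2] at h1 ⊢
  calc _ ≤ √(Bᴴ * B).trace.re * √(Bᴴ * B).trace.re := by gcongr
    _ = _ := Real.mul_self_sqrt (re_trace_conjTranspose_mul_self_nonneg B)

lemma _root_.Matrix.IsHermitian.exists_diagonalization {A : Matrix n n ℂ} (hA : A.IsHermitian) :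
    ∃ U : Matrix n n ℂ, Uᴴ * U = 1 ∧ U * Uᴴ = 1 ∧
      A = U * diagonal (fun i => (hA.eigenvalues i : ℂ)) * Uᴴ := by
  refine ⟨hA.eigenvectorUnitary, ?_, ?_, ?_⟩
  · exact Unitary.coe_star_mul_self _
  · exact Unitary.coe_mul_star_self _
  · conv_lhs => rw [hA.spectral_theorem]
    rfl

lemma conj_diagonal_mul {U : Matrix n n ℂ} (h : Uᴴ * U = 1) (a b : n → ℂ) :
    (U * diagonal a * Uᴴ) * (U * diagonal b * Uᴴ) = U * diagonal (fun i => a i * b i) * Uᴴ := by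
  rw [← diagonal_mul_diagonal]
  calc _ = U * diagonal a * (Uᴴ * U) * diagonal b * Uᴴ := by simp only [Matrix.mul_assoc]
    _ = _ := by rw [h]; simp only [Matrix.mul_assoc, Matrix.one_mul]

lemma conj_diagonal_conjTranspose (U : Matrix n n ℂ) (a : n → ℝ) :
    (U * diagonal (fun i => (a i : ℂ)) * Uᴴ)ᴴ = U * diagonal (fun i => (a i : ℂ)) * Uᴴ := by
  simp only [conjTranspose_mul, conjTranspose_conjTranspose, diagonal_conjTranspose, Matrix.mul_assoc]
  congr 3
  ext i; simp

lemma isContraction_conj_diagonal {U : Matrix n n ℂ} (h : Uᴴ * U = 1) (h' : U * Uᴴ = 1)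
    {a : n → ℝ} (ha : ∀ i, a i ^ 2 ≤ 1) :
    IsContraction (U * diagonal (fun i => (a i : ℂ)) * Uᴴ) := by
  rw [IsContraction, conj_diagonal_conjTranspose, conj_diagonal_mul h]
  have e : 1 - U * diagonal (fun i => (a i : ℂ) * a i) * Uᴴ =
      U * diagonal (fun i => ((1 - a i ^ 2 : ℝ) : ℂ)) * Uᴴ := by
    have : diagonal (fun i => ((1 - a i ^ 2 : ℝ) : ℂ)) =
        1 - diagonal (fun i => (a i : ℂ) * a i) := by
      rw [← diagonal_one, diagonal_sub]
      congr 1; ext i; push_cast; ring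
    rw [this, Matrix.mul_sub, Matrix.sub_mul, Matrix.mul_one, h']
  rw [e]
  refine PosSemidef.mul_mul_conjTranspose_same (PosSemidef.diagonal fun i => ?_) U
  have := ha i
  simp only [Pi.zero_apply, Complex.zero_le_real]
  linarith

lemma posSemidef_conj_diagonal (U : Matrix n n ℂ) {a : n → ℝ} (ha : ∀ i, 0 ≤ a i) :
    (U * diagonal (fun i => (a i : ℂ)) * Uᴴ).PosSemidef :=
  PosSemidef.mul_mul_conjTranspose_same (PosSemidef.diagonal fun i => by simpa using ha i) U

lemma trace_conj_diagonal {U : Matrix n n ℂ} (h : Uᴴ * U = 1) (a : n → ℝ) :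
    (U * diagonal (fun i => (a i : ℂ)) * Uᴴ).trace = ((∑ i, a i : ℝ) : ℂ) := by
  rw [Matrix.mul_assoc, trace_mul_comm, Matrix.mul_assoc, h, Matrix.mul_one, trace_diagonal]
  push_cast; rfl

/-- The polar decomposition `X = P √(X† X)`. -/
lemma exists_polar (X : Matrix m n ℂ) : ∃ (P : Matrix m n ℂ) (S : Matrix n n ℂ),
    IsContraction P ∧ S.PosSemidef ∧ S * S = Xᴴ * X ∧ Pᴴ * X = S ∧ X = P * S ∧
      S.trace = ∑ i, (√((isHermitian_conjTranspose_mul_self X).eigenvalues i) : ℂ) := by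
  set hX := isHermitian_conjTranspose_mul_self X
  obtain ⟨U, hU, hU', hd⟩ := hX.exists_diagonalization
  set lam := hX.eigenvalues
  have hl : ∀ i, 0 ≤ lam i := (posSemidef_conjTranspose_mul_self X).eigenvalues_nonneg
  set s : n → ℝ := fun i => √(lam i)
  have hs : ∀ i, s i * s i = lam i := fun i => Real.mul_self_sqrt (hl i)
  -- `R` is the pseudo-inverse of `S`: the convention `0⁻¹ = 0` handles the kernel, so that `X * R`
  -- is a partial isometry.
  set R := U * diagonal (fun i => ((s i)⁻¹ : ℝ) : n → ℂ) * Uᴴ with hR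
  set S := U * diagonal (fun i => (s i : ℂ)) * Uᴴ with hS
  have hRh : Rᴴ = R := conj_diagonal_conjTranspose U _
  have hRX : R * (Xᴴ * X) = S := by
    rw [hd, hR, conj_diagonal_mul hU, hS]
    congr 3; ext i
    rw [← hs i]; push_cast
    by_cases h : (s i : ℂ) = 0
    · simp [h]
    · field_simp
  refine ⟨X * R, S, ?_, posSemidef_conj_diagonal U fun i => Real.sqrt_nonneg _, ?_, ?_, ?_, ?_⟩
  · have : (X * R)ᴴ * (X * R) = S * R := by
      rw [conjTranspose_mul, hRh, ← hRX]; simp only [Matrix.mul_assoc]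
    rw [IsContraction, this]
    have e : S * R = (U * diagonal (fun i => ((if s i = 0 then 0 else 1 : ℝ) : ℂ)) * Uᴴ)ᴴ *
        (U * diagonal (fun i => ((if s i = 0 then 0 else 1 : ℝ) : ℂ)) * Uᴴ) := by
      rw [conj_diagonal_conjTranspose, hS, hR, conj_diagonal_mul hU, conj_diagonal_mul hU]
      congr 3; ext i
      by_cases h : s i = 0 <;> simp [h]
    rw [e]
    exact isContraction_conj_diagonal hU hU' fun i => by split_ifs <;> simp
  · rw [hd, hS, conj_diagonal_mul hU]
    congr 3; ext i; rw [← hs i]; push_cast; rfl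
  · rw [conjTranspose_mul, hRh, Matrix.mul_assoc, hRX]
  · have hzero : X * (1 - R * S) = 0 := by
      rw [← conjTranspose_mul_self_eq_zero, conjTranspose_mul, Matrix.mul_assoc,
        ← Matrix.mul_assoc Xᴴ]
      have : Xᴴ * X * (1 - R * S) = 0 := by
        have e : R * S = U * diagonal (fun i => ((s i)⁻¹ : ℝ) * (s i : ℂ)) * Uᴴ := by
          rw [hS, hR, conj_diagonal_mul hU]
        rw [Matrix.mul_sub, Matrix.mul_one, sub_eq_zero, e, hd, conj_diagonal_mul hU]
        congr 3; ext i; rw [← hs i]; push_cast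
        by_cases h : (s i : ℂ) = 0
        · simp [h]
        · field_simp
      rw [this, Matrix.mul_zero]
    rw [Matrix.mul_sub, Matrix.mul_one, sub_eq_zero] at hzero
    rw [Matrix.mul_assoc]; exact hzero
  · rw [hS, trace_conj_diagonal hU]; push_cast; rfl

/-- The adjoint of the polar factor attains the maximum. With the upper bound that follows, this is
the duality between trace norm and contractions, which replaces work with eigenvalues in later
estimates. -/
lemma exists_trace_eq_traceNorm (X : Matrix n n ℂ) :
    ∃ H : Matrix n n ℂ, IsContraction H ∧ (H * X).trace = traceNorm X := by
  obtain ⟨P, S, hP, -, -, hPX, -, htr⟩ := exists_polar X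
  refine ⟨Pᴴ, hP.conjTranspose, ?_⟩
  rw [hPX, htr, traceNorm]; push_cast; rfl

lemma IsContraction.norm_trace_mul_le_traceNorm {H : Matrix n n ℂ} (hH : IsContraction H)
    (X : Matrix n n ℂ) : ‖(H * X).trace‖ ≤ traceNorm X := by
  obtain ⟨P, S, hP, hS, -, -, hX, htr⟩ := exists_polar X
  have : traceNorm X = S.trace.re := by rw [htr, traceNorm, Complex.re_sum]; simp
  rw [this]
  conv_lhs => rw [hX, ← Matrix.mul_assoc]
  exact (hH.mul hP).norm_trace_mul_le hS

lemma traceNorm_le_of_forall {X : Matrix n n ℂ} {c : ℝ}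
    (h : ∀ H : Matrix n n ℂ, IsContraction H → ‖(H * X).trace‖ ≤ c) : traceNorm X ≤ c := by
  obtain ⟨H, hH, e⟩ := exists_trace_eq_traceNorm X
  have := h H hH
  rw [e, Complex.norm_real] at this
  exact (le_abs_self _).trans this

lemma traceNorm_neg (X : Matrix n n ℂ) : traceNorm (-X) = traceNorm X := by
  have key : ∀ Y : Matrix n n ℂ, traceNorm (-Y) ≤ traceNorm Y := fun Y =>
    traceNorm_le_of_forall fun H hH => by
      rw [mul_neg, trace_neg, norm_neg]; exact hH.norm_trace_mul_le_traceNorm Y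
  exact le_antisymm (key X) (by simpa using key (-X))

lemma traceNorm_sub_le (X Y : Matrix n n ℂ) : traceNorm (X - Y) ≤ traceNorm X + traceNorm Y :=
  traceNorm_le_of_forall fun H hH => by
    rw [Matrix.mul_sub, trace_sub]
    exact (norm_sub_le _ _).trans (add_le_add (hH.norm_trace_mul_le_traceNorm X)
      (hH.norm_trace_mul_le_traceNorm Y))

lemma traceNorm_le_of_posSemidef {S : Matrix n n ℂ} (hS : S.PosSemidef) :
    traceNorm S ≤ S.trace.re :=
  traceNorm_le_of_forall fun _ hH => hH.norm_trace_mul_le hS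

/-- The Jordan decomposition of a Hermitian operator, with its trace norm. -/
lemma _root_.Matrix.IsHermitian.exists_jordan {X : Matrix n n ℂ} (hX : X.IsHermitian) :
    ∃ A B : Matrix n n ℂ, A.PosSemidef ∧ B.PosSemidef ∧ X = A - B ∧
      A.trace.re + B.trace.re ≤ traceNorm X := by
  obtain ⟨U, hU, hU', hd⟩ := hX.exists_diagonalization
  set d := hX.eigenvalues
  refine ⟨U * diagonal (fun i => (max (d i) 0 : ℝ) : n → ℂ) * Uᴴ,
    U * diagonal (fun i => (max (-d i) 0 : ℝ) : n → ℂ) * Uᴴ,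
    posSemidef_conj_diagonal U fun i => le_max_right _ _,
    posSemidef_conj_diagonal U fun i => le_max_right _ _, ?_, ?_⟩
  · rw [← Matrix.sub_mul, ← Matrix.mul_sub, diagonal_sub]
    conv_lhs => rw [hd]
    congr 3; ext i
    norm_cast
    rcases le_total (d i) 0 with h | h <;> simp [h]
  -- Pairing `X` with its sign operator gives the sum of the absolute eigenvalues.
  · set W := U * diagonal (fun i => ((if 0 ≤ d i then 1 else -1 : ℝ) : ℂ)) * Uᴴ
    have hW : IsContraction W :=
      isContraction_conj_diagonal hU hU' fun i => by split_ifs <;> simp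
    have h := hW.norm_trace_mul_le_traceNorm X
    have e : W * X = U * diagonal (fun i => ((max (d i) 0 + max (-d i) 0 : ℝ) : ℂ)) * Uᴴ := by
      conv_lhs => rw [hd, conj_diagonal_mul hU]
      congr 3; ext i; norm_cast
      rcases lt_or_ge (d i) 0 with h | h
      · simp [h.le, h.not_ge]
      · simp [h]
    rw [e, trace_conj_diagonal hU, Complex.norm_real] at h
    rw [trace_conj_diagonal hU, trace_conj_diagonal hU, Complex.ofReal_re, Complex.ofReal_re,
      ← Finset.sum_add_distrib]
    exact (le_abs_self _).trans h

/-- The Powers-Størmer inequality, for unit Hilbert-Schmidt vectors. -/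
lemma one_sub_half_traceNorm_le {S T : Matrix n n ℂ} (hS : S.PosSemidef) (hT : T.PosSemidef)
    (hS1 : (S * S).trace = 1) (hT1 : (T * T).trace = 1) :
    1 - traceNorm (S * S - T * T) / 2 ≤ (S * T).trace.re := by
  have hD : (S - T).IsHermitian := hS.1.sub hT.1
  obtain ⟨U, hU, hU', hd⟩ := hD.exists_diagonalization
  set d := hD.eigenvalues
  -- The test contraction is the sign of `S - T`, and `A` is its absolute value. The target is `‖S²
  -- - T²‖₁ ≥ tr (S - T)² = 2 - 2 tr(S T)`.
  set W := U * diagonal (fun i => ((SignType.sign (d i) : ℝ) : ℂ)) * Uᴴ with hWdef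
  set A := U * diagonal (fun i => (|d i| : ℝ) : n → ℂ) * Uᴴ with hA
  have hW : IsContraction W := isContraction_conj_diagonal hU hU' fun i => by
    rcases lt_trichotomy (d i) 0 with h | h | h <;> simp [h]
  have hWD : W * (S - T) = A := by
    rw [hd, conj_diagonal_mul hU]
    congr 3; ext i; norm_cast; exact sign_mul_self _
  have hDW : (S - T) * W = A := by
    rw [hd, conj_diagonal_mul hU]
    congr 3; ext i; norm_cast; exact self_mul_sign _
  have h := hW.norm_trace_mul_le_traceNorm (S * S - T * T)
  have e1 : (W * (S * S - T * T)).trace = (A * (S + T)).trace := by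
    -- Since `S` and `T` need not commute, the difference of squares is factored symmetrically; `W`
    -- then meets `S - T` from either side under the trace.
    have : S * S - T * T = (2⁻¹ : ℂ) • ((S - T) * (S + T) + (S + T) * (S - T)) := by
      have : (S - T) * (S + T) + (S + T) * (S - T) = (2 : ℂ) • (S * S - T * T) := by
        rw [two_smul]; noncomm_ring
      rw [this, smul_smul]; norm_num
    rw [this, Matrix.mul_smul, trace_smul, Matrix.mul_add, trace_add, ← Matrix.mul_assoc, hWD, ← Matrix.mul_assoc,
      trace_mul_cycle W (S + T), hDW, smul_eq_mul]
    ring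
  have e2 : (A * (S + T)).trace.re = ∑ i, ((|d i| : ℝ) * (Uᴴ * (S + T) * U) i i : ℂ).re := by
    rw [hA, Matrix.mul_assoc, Matrix.mul_assoc, trace_mul_comm, Matrix.mul_assoc]
    simp only [trace, diag_apply, diagonal_mul, Matrix.mul_assoc, Complex.re_sum]
  have e3 : ∑ i, d i ^ 2 ≤ (A * (S + T)).trace.re := by
    rw [e2]
    -- In the eigenbasis of `S - T`, each eigenvalue is a difference of nonnegative diagonal entries
    -- of `S` and `T`, hence bounded in modulus by their sum.
    refine Finset.sum_le_sum fun i _ => ?_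
    rw [Complex.re_ofReal_mul, ← sq_abs, sq]
    refine mul_le_mul_of_nonneg_left ?_ (abs_nonneg _)
    have hDd : Uᴴ * (S - T) * U = diagonal fun i => (d i : ℂ) := by
      calc _ = (Uᴴ * U) * diagonal (fun i => (d i : ℂ)) * (Uᴴ * U) := by
            rw [hd]; simp only [Matrix.mul_assoc]
        _ = _ := by rw [hU, Matrix.one_mul, Matrix.mul_one]
    have hDi := congrArg Complex.re (congrFun (congrFun hDd i) i)
    rw [diagonal_apply_eq, Complex.ofReal_re, Matrix.mul_sub, Matrix.sub_mul, Matrix.sub_apply,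
      Complex.sub_re] at hDi
    have hSi := (Complex.le_def.1 ((hS.conjTranspose_mul_mul_same U).diag_nonneg (i := i))).1
    have hTi := (Complex.le_def.1 ((hT.conjTranspose_mul_mul_same U).diag_nonneg (i := i))).1
    rw [Matrix.mul_add, Matrix.add_mul, Matrix.add_apply, Complex.add_re, ← hDi, abs_le]
    simp only [Complex.zero_re] at hSi hTi
    constructor <;> linarith
  have e4 : ∑ i, d i ^ 2 = 2 - 2 * (S * T).trace.re := by
    have e : (S - T) * (S - T) = U * diagonal (fun i => ((d i ^ 2 : ℝ) : ℂ)) * Uᴴ := by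
      rw [hd, conj_diagonal_mul hU]
      congr 3; ext i; push_cast; ring
    have := congrArg Matrix.trace e
    rw [trace_conj_diagonal hU, Matrix.sub_mul, Matrix.mul_sub, Matrix.mul_sub, trace_sub, trace_sub, trace_sub,
      hS1, hT1, trace_mul_comm T S] at this
    have := congrArg Complex.re this
    simp only [Complex.sub_re, Complex.one_re, Complex.ofReal_re] at this
    linarith
  have e5 := (Complex.re_le_norm _).trans h
  rw [e1] at e5
  linarith

/-- Uhlmann's theorem combined with the Fuchs-van de Graaf inequality. -/
lemma exists_contraction_re_trace {p q : Type*} [Fintype p] [Fintype q] [DecidableEq p]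
    [DecidableEq q] (X : Matrix n p ℂ) (Y : Matrix n q ℂ)
    (hX : (X * Xᴴ).trace = 1) (hY : (Y * Yᴴ).trace = 1) :
    ∃ C : Matrix q p ℂ, IsContraction C ∧
      1 - traceNorm (X * Xᴴ - Y * Yᴴ) / 2 ≤ (Yᴴ * X * Cᵀ).trace.re := by
  obtain ⟨P, S, hP, hS, hSS, hPX, -, -⟩ := exists_polar Xᴴ
  obtain ⟨R, T, hR, hT, hTT, hRY, -, -⟩ := exists_polar Yᴴ
  rw [conjTranspose_conjTranspose] at hSS hTT
  -- Here `X P = S = √(X X†)` and `R† Y† = T = √(Y Y†)`, so this choice makes the overlap equal to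
  -- `tr (S T)`.
  refine ⟨(P * Rᴴ)ᵀ, (hP.mul hR.conjTranspose).transpose, ?_⟩
  have h := one_sub_half_traceNorm_le hS hT (hSS ▸ hX) (hTT ▸ hY)
  rw [hSS, hTT] at h
  refine h.trans (le_of_eq ?_)
  have hXP : X * P = S := by
    have := congrArg Matrix.conjTranspose hPX
    rwa [conjTranspose_mul, conjTranspose_conjTranspose, conjTranspose_conjTranspose,
      hS.1.eq] at this
  rw [transpose_transpose]
  have : Yᴴ * X * (P * Rᴴ) = Yᴴ * (S * Rᴴ) := by rw [← hXP]; simp only [Matrix.mul_assoc]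
  rw [this, trace_mul_comm Yᴴ, Matrix.mul_assoc, hRY]

end TraceNorm

/-! ### Channels, partial traces, and the Stinespring dilation. -/

section Channels

variable {A B C D R : Type*} [Fintype A] [Fintype B] [Fintype C] [Fintype D] [Fintype R]

/-- Conjugation `X ↦ V X V†`. -/
def conj (V : Matrix B A ℂ) : SuperOp A B where
  toFun X := V * X * Vᴴ
  map_add' X Y := by rw [Matrix.mul_add, Matrix.add_mul]
  map_smul' c X := by simp

lemma conj_apply (V : Matrix B A ℂ) (X : Op A) : conj V X = V * X * Vᴴ := rfl

lemma conj_comp (V : Matrix C B ℂ) (W : Matrix B A ℂ) : conj V ∘ₗ conj W = conj (V * W) := by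
  ext1 X
  simp only [LinearMap.comp_apply, conj_apply, conjTranspose_mul, Matrix.mul_assoc]

lemma onRight_apply (R : Type*) (Φ : SuperOp A B) (X : Op (R × A)) (p q : R × B) :
    onRight R Φ X p q = Φ (Matrix.of fun a a' => X (p.1, a) (q.1, a')) p.2 q.2 := rfl

lemma onLeft_apply (R : Type*) (Φ : SuperOp A B) (X : Op (A × R)) (p q : B × R) :
    onLeft R Φ X p q = Φ (Matrix.of fun a a' => X (a, p.2) (a', q.2)) p.1 q.1 := rfl

lemma onRight_comp (R : Type*) (Φ : SuperOp B C) (Ψ : SuperOp A B) :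
    onRight R (Φ ∘ₗ Ψ) = onRight R Φ ∘ₗ onRight R Ψ := rfl

lemma onRight_conj (R : Type*) [Fintype R] [DecidableEq R] (V : Matrix B A ℂ) (X : Op (R × A)) :
    onRight R (conj V) X = ((1 : Matrix R R ℂ) ⊗ₖ V) * X * ((1 : Matrix R R ℂ) ⊗ₖ V)ᴴ := by
  ext p q
  simp [onRight_apply, conj_apply, mul_apply, Fintype.sum_prod_type, one_apply,
    apply_ite (starRingEnd ℂ), Finset.sum_mul]

lemma onRight_submatrix {R S : Type*} (e : S → R) (Φ : SuperOp A B) (X : Op (R × A)) :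
    onRight S Φ (X.submatrix (Prod.map e id) (Prod.map e id)) =
      (onRight R Φ X).submatrix (Prod.map e id) (Prod.map e id) := rfl

/-- Relabelling a basis carries complete positivity from the ancillas `Fin k` to any finite ancilla.
-/
lemma IsChannel.posSemidef_onRight {Φ : SuperOp A B} (h : IsChannel Φ) {X : Op (R × A)}
    (hX : X.PosSemidef) : (onRight R Φ X).PosSemidef := by
  let e := Fintype.equivFin R
  have h1 := h.completelyPositive _ _ (hX.submatrix (Prod.map e.symm id))
  rw [onRight_submatrix] at h1
  have h2 := h1.submatrix (Prod.map e id)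
  convert h2 using 1
  ext ⟨r, b⟩ ⟨r', b'⟩
  simp [submatrix_apply]

lemma IsChannel.posSemidef {Φ : SuperOp A B} (h : IsChannel Φ) {X : Op A}
    (hX : X.PosSemidef) : (Φ X).PosSemidef :=
  (h.posSemidef_onRight (R := Unit) (hX.submatrix Prod.snd)).submatrix (fun b => ((), b))

lemma trace_onRight {Φ : SuperOp A B} (h : ∀ X, (Φ X).trace = X.trace) (X : Op (R × A)) :
    (onRight R Φ X).trace = X.trace := by
  simp only [trace, diag_apply, Fintype.sum_prod_type, onRight_apply]
  exact Finset.sum_congr rfl fun r _ => h (Matrix.of fun a a' => X (r, a) (r, a'))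

lemma IsChannel.isDensity {Φ : SuperOp A B} (h : IsChannel Φ) {ρ : Op A} (hρ : IsDensity ρ) :
    IsDensity (Φ ρ) :=
  ⟨h.posSemidef hρ.posSemidef, (h.tracePreserving ρ).trans hρ.trace_eq_one⟩

lemma IsChannel.comp {Φ : SuperOp B C} {Ψ : SuperOp A B} (hΦ : IsChannel Φ) (hΨ : IsChannel Ψ) :
    IsChannel (Φ ∘ₗ Ψ) where
  completelyPositive k X hX := hΦ.completelyPositive k _ (hΨ.completelyPositive k X hX)
  tracePreserving X := (hΦ.tracePreserving _).trans (hΨ.tracePreserving X)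

lemma isChannel_conj [DecidableEq A] {V : Matrix B A ℂ} (hV : Vᴴ * V = 1) :
    IsChannel (conj V) where
  completelyPositive k X hX := by
    rw [onRight_conj]
    exact hX.mul_mul_conjTranspose_same _
  tracePreserving X := by
    rw [conj_apply, trace_mul_comm, ← Matrix.mul_assoc, hV, Matrix.one_mul]

/-- Testing on matrix units reads off each entry of `V† V`. Dilations are thus isometries as soon as
the dilated map preserves the trace. -/
lemma conjTranspose_mul_self_of_tracePreserving [DecidableEq A] {V : Matrix B A ℂ}
    (h : ∀ X, (conj V X).trace = X.trace) : Vᴴ * V = 1 := by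
  ext i j
  have := h (Matrix.single j i 1)
  rw [conj_apply, trace_mul_comm, ← Matrix.mul_assoc, trace_mul_single] at this
  by_cases hij : i = j
  · subst hij
    simpa using this
  · simpa [hij, trace_single_eq_of_ne _ _ _ (Ne.symm hij)] using this

lemma isChannel_reindex (e : A ≃ B) :
    IsChannel (Matrix.reindexLinearEquiv ℂ ℂ e e).toLinearMap where
  completelyPositive _ _ hX := hX.submatrix (Prod.map id e.symm)
  tracePreserving X := by
    simp only [trace, diag_apply]
    exact Equiv.sum_comp e.symm fun a => X a a

lemma isChannel_traceRight : IsChannel (traceRight : SuperOp (A × B) A) where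
  completelyPositive k X hX := by
    have : onRight (Fin k) traceRight X = ∑ b : B, X.submatrix
        (fun p : Fin k × A => (p.1, (p.2, b))) (fun p : Fin k × A => (p.1, (p.2, b))) := by
      ext p q
      simp [onRight_apply, traceRight, Matrix.sum_apply]
    rw [this]
    exact posSemidef_sum _ fun b _ => hX.submatrix _
  tracePreserving X := by
    simp [trace, traceRight, Fintype.sum_prod_type]

lemma isChannel_traceLeft : IsChannel (traceLeft : SuperOp (A × B) B) where
  completelyPositive k X hX := by
    have : onRight (Fin k) traceLeft X = ∑ a : A, X.submatrix
        (fun p : Fin k × B => (p.1, (a, p.2))) (fun p : Fin k × B => (p.1, (a, p.2))) := by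
      ext p q
      simp [onRight_apply, traceLeft, Matrix.sum_apply]
    rw [this]
    exact posSemidef_sum _ fun b _ => hX.submatrix _
  tracePreserving X := by
    simp [trace, traceLeft, Fintype.sum_prod_type_right]

lemma isChannel_discardPrepare {σ : Op B} (hσ : IsDensity σ) :
    IsChannel (discardPrepare σ : SuperOp A B) where
  completelyPositive k X hX := by
    have : onRight (Fin k) (discardPrepare σ) X = traceRight X ⊗ₖ σ := by
      ext p q
      simp [onRight_apply, discardPrepare, traceRight, trace]
    rw [this]
    exact (isChannel_traceRight.posSemidef hX).kronecker hσ.posSemidef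
  tracePreserving _ := by
    simp [discardPrepare, trace_smul, hσ.trace_eq_one]

lemma isChannel_attach {Q L R : Type*} [Fintype Q] [Fintype L] [Fintype R] {ρ : Op (L × R)}
    (hρ : IsDensity ρ) : IsChannel (attach ρ : SuperOp Q ((Q × L) × R)) where
  completelyPositive k X hX := by
    exact (hX.kronecker hρ.posSemidef).submatrix
      (fun p : Fin k × ((Q × L) × R) => ((p.1, p.2.1.1), (p.2.1.2, p.2.2)))
  tracePreserving X := by
    have h : (X ⊗ₖ ρ).trace = X.trace := by rw [trace_kronecker, hρ.trace_eq_one, mul_one]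
    rw [← h]
    simp only [trace, diag_apply, attach, Fintype.sum_prod_type, kroneckerMap_apply]
    rfl

lemma isChannel_onRight (R : Type*) [Fintype R] {Φ : SuperOp A B} (h : IsChannel Φ) :
    IsChannel (onRight R Φ) where
  completelyPositive k _ hX :=
    (h.posSemidef_onRight (hX.submatrix
      (fun p : (Fin k × R) × A => (p.1.1, (p.1.2, p.2))))).submatrix
        (fun p : Fin k × (R × B) => ((p.1, p.2.1), p.2.2))
  tracePreserving := trace_onRight h.tracePreserving

lemma isChannel_onLeft (R : Type*) [Fintype R] {Φ : SuperOp A B} (h : IsChannel Φ) :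
    IsChannel (onLeft R Φ) :=
  (isChannel_reindex (Equiv.prodComm R B)).comp
    ((isChannel_onRight R h).comp (isChannel_reindex (Equiv.prodComm A R)))

lemma isChannel_tensorMap {Φ : SuperOp A C} {Ψ : SuperOp B D} (hΦ : IsChannel Φ)
    (hΨ : IsChannel Ψ) : IsChannel (tensorMap Φ Ψ) :=
  (isChannel_onLeft D hΦ).comp (isChannel_onRight A hΨ)

lemma apply_eq_sum_single [DecidableEq A] (Φ : SuperOp A B) (X : Op A) (b b' : B) :
    Φ X b b' = ∑ a, ∑ a', X a a' * Φ (Matrix.single a a' 1) b b' := by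
  conv_lhs => rw [matrix_eq_sum_single X]
  simp only [map_sum, Matrix.sum_apply]
  refine Finset.sum_congr rfl fun a _ => Finset.sum_congr rfl fun a' _ => ?_
  rw [show Matrix.single a a' (X a a') = X a a' • Matrix.single a a' (1 : ℂ) by simp, map_smul]
  rfl

/-- The Stinespring dilation of a channel. -/
lemma IsChannel.exists_stinespring [DecidableEq A] [DecidableEq B] {E : Type*} [Fintype E]
    (e : E ≃ A × B) {Φ : SuperOp A B}
    (h : IsChannel Φ) : ∃ V : Matrix (B × E) A ℂ, Vᴴ * V = 1 ∧ Φ = traceRight ∘ₗ conj V := by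
  -- `ω` is the unnormalized maximally entangled vector and its image is the Choi operator. The rows
  -- of the Gram factor `K` are the conjugated Kraus operators, stacked along the environment by
  -- `e`.
  let ω : A × A → ℂ := fun p => if p.1 = p.2 then 1 else 0
  have hJ := h.posSemidef_onRight (posSemidef_vecMulVec_self_star ω)
  obtain ⟨K, hK⟩ := hJ.exists_conjTranspose_mul_self
  have hΦ : Φ = traceRight ∘ₗ
      conj (Matrix.of fun (p : B × E) (a : A) => star (K (e p.2) (a, p.1))) := by
    ext X b b'
    rw [apply_eq_sum_single]
    have key : ∀ a a', Φ (Matrix.single a a' 1) b b' =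
        ∑ i, star (K i (a, b)) * K i (a', b') := fun a a' => by
      have := congrFun (congrFun hK (a, b)) (a', b')
      rw [mul_apply] at this
      simp only [conjTranspose_apply] at this
      rw [← this, onRight_apply]
      refine congrArg (fun M => Φ M b b') (Matrix.ext fun i j => ?_)
      simp only [ω, vecMulVec_apply, single_apply, of_apply, Pi.star_apply]
      split_ifs <;> simp_all
    simp only [key, LinearMap.comp_apply, traceRight, conj_apply, LinearMap.coe_mk, AddHom.coe_mk,
      of_apply, mul_apply, conjTranspose_apply, star_star]
    rw [e.sum_comp fun i => ∑ x_1, (∑ j, star (K i (j, b)) * X j x_1) * K i (x_1, b')]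
    simp only [Finset.sum_mul, Finset.mul_sum]
    rw [Finset.sum_comm_cycle]
    conv_rhs => enter [2, x]; rw [Finset.sum_comm]
    refine Finset.sum_congr rfl fun _ _ => Finset.sum_congr rfl fun _ _ =>
      Finset.sum_congr rfl fun _ _ => by ring
  refine ⟨_, conjTranspose_mul_self_of_tracePreserving fun X => ?_, hΦ⟩
  rw [← h.tracePreserving X]
  conv_rhs => rw [hΦ]
  exact (isChannel_traceRight.tracePreserving _).symm

lemma traceRight_comp_reindex_tensorMap {C' D' : Type*} [Fintype C'] [Fintype D']
    (Φ : SuperOp A (C × C')) (Ψ : SuperOp B (D × D')) :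
    (traceRight : SuperOp ((C × D) × (C' × D')) (C × D)) ∘ₗ (Matrix.reindexLinearEquiv ℂ ℂ
      (Equiv.prodProdProdComm C C' D D') (Equiv.prodProdProdComm C C' D D')).toLinearMap ∘ₗ
      tensorMap Φ Ψ = tensorMap (traceRight ∘ₗ Φ) (traceRight ∘ₗ Ψ) := by
  refine LinearMap.ext fun X => Matrix.ext fun p q => ?_
  have key : ∀ c', (Φ (Matrix.of fun a a' => ∑ d', Ψ (Matrix.of fun b b' => X (a, b) (a', b'))
      (p.2, d') (q.2, d'))) (p.1, c') (q.1, c') = ∑ d', (Φ (Matrix.of fun a a' =>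
        Ψ (Matrix.of fun b b' => X (a, b) (a', b')) (p.2, d') (q.2, d'))) (p.1, c') (q.1, c') := by
    intro c'
    rw [← Matrix.sum_apply, ← map_sum]
    refine congrArg (fun M => Φ M (p.1, c') (q.1, c')) (Matrix.ext fun a a' => ?_)
    simp [Matrix.sum_apply]
  simp only [LinearMap.comp_apply, traceRight, LinearMap.coe_mk, AddHom.coe_mk, of_apply,
    Fintype.sum_prod_type, tensorMap, onLeft_apply, onRight_apply, key]
  rfl

lemma traceLeft_comp_onRight (Φ : SuperOp A B) :
    (traceLeft : SuperOp (R × B) B) ∘ₗ onRight R Φ = Φ ∘ₗ traceLeft := by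
  refine LinearMap.ext fun X => Matrix.ext fun b b' => ?_
  simp only [LinearMap.comp_apply, traceLeft, LinearMap.coe_mk, AddHom.coe_mk, of_apply,
    onRight_apply]
  rw [← Matrix.sum_apply, ← map_sum]
  refine congrArg (fun M => Φ M b b') (Matrix.ext fun a a' => ?_)
  simp [Matrix.sum_apply]

lemma traceLeft_comp_conj_kronecker [DecidableEq R] (V : Matrix B A ℂ) :
    (traceLeft : SuperOp (R × B) B) ∘ₗ conj ((1 : Matrix R R ℂ) ⊗ₖ V) =
      conj V ∘ₗ traceLeft := by
  rw [← traceLeft_comp_onRight]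
  congr 1
  exact LinearMap.ext fun X => (onRight_conj R V X).symm

/-- No signalling: acting on a system that is then discarded does not disturb the other one. -/
lemma traceRight_comp_onRight {Φ : SuperOp A B} (h : IsChannel Φ) :
    (traceRight : SuperOp (R × B) R) ∘ₗ onRight R Φ = traceRight := by
  ext X r r'
  exact h.tracePreserving (Matrix.of fun a a' => X (r, a) (r', a'))

end Channels

/-! ### Compact convex sets of states and contractions, and minimax. -/

section Minimax

variable {m n p q : Type*} [Fintype m] [Fintype n] [Fintype p] [Fintype q]
  [DecidableEq m] [DecidableEq n] [DecidableEq p] [DecidableEq q]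

open scoped Matrix.Norms.L2Operator in
lemma isCompact_setOf_isContraction : IsCompact {C : Matrix m n ℂ | IsContraction C} := by
  have : {C : Matrix m n ℂ | IsContraction C} = Metric.closedBall 0 1 := by
    ext C
    simp [isContraction_iff_norm_le_one]
  rw [this]
  have : ProperSpace (Matrix m n ℂ) := FiniteDimensional.proper ℂ _
  exact isCompact_closedBall _ _

open scoped Matrix.Norms.L2Operator in
lemma convex_setOf_isContraction : Convex ℝ {C : Matrix m n ℂ | IsContraction C} := by
  intro C hC D hD a b ha hb hab
  simp only [Set.mem_ofPred_eq, isContraction_iff_norm_le_one] at *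
  have e : a • C + b • D = (a : ℂ) • C + (b : ℂ) • D := by simp
  rw [e]
  refine (norm_add_le _ _).trans ?_
  rw [norm_smul, norm_smul, Complex.norm_real, Complex.norm_real, Real.norm_of_nonneg ha,
    Real.norm_of_nonneg hb, ← hab]
  gcongr
  · exact mul_le_of_le_one_right ha hC
  · exact mul_le_of_le_one_right hb hD

lemma convex_setOf_isDensity : Convex ℝ {ρ : Op n | IsDensity ρ} := by
  intro ρ hρ σ hσ a b ha hb hab
  have e : a • ρ + b • σ = (a : ℂ) • ρ + (b : ℂ) • σ := by simp
  simp only [Set.mem_ofPred_eq]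
  rw [e]
  refine ⟨(hρ.posSemidef.smul (by simpa using ha)).add (hσ.posSemidef.smul (by simpa using hb)), ?_⟩
  rw [trace_add, trace_smul, trace_smul, hρ.trace_eq_one, hσ.trace_eq_one]
  simpa using congrArg Complex.ofReal hab

lemma isContraction_single (i : m) (j : n) : IsContraction (Matrix.single i j (1 : ℂ)) := by
  rw [IsContraction]
  have : (1 : Matrix n n ℂ) - (Matrix.single i j (1 : ℂ))ᴴ * Matrix.single i j (1 : ℂ) =
      diagonal fun k => if k = j then 0 else 1 := by
    rw [conjTranspose_single, star_one, single_mul_single_same]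
    rw [← diagonal_single, ← diagonal_one, diagonal_sub]
    congr 1
    ext k
    by_cases h : k = j
    · subst h; simp
    · simp [h]
  rw [this]
  exact PosSemidef.diagonal fun k => by simp only [Pi.zero_apply]; split_ifs <;> simp

/-- An entry is a pairing with a matrix unit, which is a contraction. This is the boundedness behind
compactness of the state space. -/
lemma IsDensity.norm_apply_le {ρ : Op n} (hρ : IsDensity ρ) (i j : n) : ‖ρ i j‖ ≤ 1 := by
  have h := (isContraction_single j i).norm_trace_mul_le hρ.posSemidef
  rw [trace_mul_comm, trace_mul_single, hρ.trace_eq_one] at h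
  simpa using h

lemma isCompact_setOf_isDensity : IsCompact {ρ : Op n | IsDensity ρ} := by
  have hK : IsCompact (Set.univ.pi fun _ : n => Set.univ.pi fun _ : n =>
      Metric.closedBall (0 : ℂ) 1) :=
    isCompact_univ_pi fun _ => isCompact_univ_pi fun _ => isCompact_closedBall _ _
  refine IsCompact.of_isClosed_subset (X := n → n → ℂ) hK ?_ ?_
  · have : {ρ : Op n | IsDensity ρ} = {ρ : Op n | ρᴴ = ρ} ∩
        (⋂ x : n → ℂ, {ρ : Op n | 0 ≤ star x ⬝ᵥ (ρ *ᵥ x)}) ∩ {ρ | ρ.trace = 1} := by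
      ext ρ
      simp only [Set.mem_ofPred_eq, Set.mem_inter_iff, Set.mem_iInter]
      rw [← IsHermitian, ← posSemidef_iff_dotProduct_mulVec]
      exact ⟨fun h => ⟨h.1, h.2⟩, fun h => ⟨h.1, h.2⟩⟩
    show @IsClosed (Op n) _ _
    rw [this]
    refine ((isClosed_eq (by fun_prop) continuous_id).inter (isClosed_iInter fun x => ?_)).inter
      (isClosed_eq (by fun_prop) continuous_const)
    exact isClosed_le continuous_const (by fun_prop)
  · intro ρ hρ i _ j _
    simpa using IsDensity.norm_apply_le hρ i j

/-- The minimax theorem for a bilinear pairing of states with contractions. -/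
lemma exists_contraction_forall_density (L : Matrix p q ℂ →ₗ[ℂ] Op n) (t : ℝ)
    (h : ∀ ρ, IsDensity ρ → ∃ C, IsContraction C ∧ t ≤ (ρ * L C).trace.re) :
    ∃ C, IsContraction C ∧ ∀ ρ, IsDensity ρ → t ≤ (ρ * L C).trace.re := by
  by_cases hne : {ρ : Op n | IsDensity ρ}.Nonempty
  swap
  · refine ⟨0, ?_, fun ρ hρ => (hne ⟨ρ, hρ⟩).elim⟩
    simpa [IsContraction] using PosSemidef.one
  have hne' : {C : Matrix p q ℂ | IsContraction C}.Nonempty := by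
    obtain ⟨ρ, hρ⟩ := hne
    obtain ⟨C, hC, -⟩ := h ρ hρ
    exact ⟨C, hC⟩
  let g : Matrix p q ℂ → (Op n →ₗ[ℝ] ℝ) := fun C =>
    Complex.reLm ∘ₗ Matrix.traceLinearMap n ℝ ℂ ∘ₗ LinearMap.mulRight ℝ (L C)
  let k : Op n → (Matrix p q ℂ →ₗ[ℝ] ℝ) := fun ρ =>
    Complex.reLm ∘ₗ Matrix.traceLinearMap n ℝ ℂ ∘ₗ LinearMap.mulLeft ℝ ρ ∘ₗ L.restrictScalars ℝ
  have hg : ∀ C, Continuous (g C) := fun C => LinearMap.continuous_of_finiteDimensional _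
  have hk : ∀ ρ, Continuous (k ρ) := fun ρ => LinearMap.continuous_of_finiteDimensional _
  obtain ⟨a, ha, b, hb, hab⟩ := Sion.exists_isSaddlePointOn
    (X := {ρ : Op n | IsDensity ρ}) (Y := {C : Matrix p q ℂ | IsContraction C})
    (f := fun ρ C => (ρ * L C).trace.re) hne convex_setOf_isDensity isCompact_setOf_isDensity
    (fun C _ => (hg C).lowerSemicontinuous.lowerSemicontinuousOn _)
    (fun C _ => ((g C).convexOn convex_setOf_isDensity).quasiconvexOn)
    convex_setOf_isContraction hne' isCompact_setOf_isContraction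
    (fun ρ _ => (hk ρ).upperSemicontinuous.upperSemicontinuousOn _)
    (fun ρ _ => ((k ρ).concaveOn convex_setOf_isContraction).quasiconcaveOn)
  obtain ⟨C, hC, hCt⟩ := h a ha
  -- At the saddle point `(a, b)`, the value of `b` on any state is at least that of any contraction
  -- on `a`, in particular of the `C` supplied for `a`.
  exact ⟨b, hb, fun ρ hρ => hCt.trans (hab ρ hρ C hC)⟩

end Minimax

/-! ### Continuity of the Stinespring dilation. -/

section Continuity

variable {A : Type*} [Fintype A] [DecidableEq A] {p q : Type*} [Fintype p] [Fintype q]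
  [DecidableEq p] [DecidableEq q] {k : ℕ}

lemma le_diamondDist {B C : Type*} [Fintype B] [Fintype C] [DecidableEq C] {Φ Ψ : SuperOp B C}
    {δ : ℝ} (h : diamondDist Φ Ψ ≤ (δ : EReal)) {d : ℕ} {ρ : Op (Fin d × B)} (hρ : IsDensity ρ) :
    traceNorm (onRight (Fin d) Φ ρ - onRight (Fin d) Ψ ρ) ≤ δ := by
  rw [← EReal.coe_le_coe_iff]
  refine le_trans ?_ h
  exact le_iSup_of_le d (le_iSup₂_of_le ρ hρ le_rfl)

/-- `A`-marginals of a purified state, in terms of its coefficient matrix. -/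
lemma onRight_traceRight_conj_vecMulVec {Q R : Type*} [Fintype Q] [Fintype R]
    (V : Matrix (A × p) Q ℂ) (S : Matrix Q R ℂ) :
    onRight R (traceRight ∘ₗ conj V)
      (vecMulVec (fun x : R × Q => S x.2 x.1) (star fun x : R × Q => S x.2 x.1)) =
    (Matrix.of fun (x : R × A) e => (V * S) (x.2, e) x.1) *
      (Matrix.of fun (x : R × A) e => (V * S) (x.2, e) x.1)ᴴ := by
  ext ⟨i, a⟩ ⟨j, b⟩
  simp only [onRight_apply, LinearMap.comp_apply, traceRight, LinearMap.coe_mk, AddHom.coe_mk,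
    of_apply, mul_apply, conjTranspose_apply, conj_apply, vecMulVec_apply, Pi.star_apply,
    star_sum, star_mul']
  refine Finset.sum_congr rfl fun e _ => ?_
  simp only [Finset.sum_mul, Finset.mul_sum]
  refine Finset.sum_congr rfl fun _ _ => Finset.sum_congr rfl fun _ _ => by ring

/-- Moving the environment from the row index to the column index turns `C` into right
multiplication by `Cᵀ`, the form delivered by `exists_contraction_re_trace`. -/
lemma trace_conjTranspose_mul_kronecker_mul {R : Type*} [Fintype R]
    (X : Matrix (A × p) R ℂ) (Y : Matrix (A × q) R ℂ) (C : Matrix q p ℂ) :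
    (Yᴴ * ((1 : Matrix A A ℂ) ⊗ₖ C) * X).trace =
      ((Matrix.of fun (x : R × A) e => Y (x.2, e) x.1)ᴴ *
        (Matrix.of fun (x : R × A) e => X (x.2, e) x.1) * Cᵀ).trace := by
  have key : ∀ a e i, (((1 : Matrix A A ℂ) ⊗ₖ C) * X) (a, e) i = ∑ e', C e e' * X (a, e') i := by
    intro a e i
    simp [mul_apply, Fintype.sum_prod_type, one_apply]
  rw [Matrix.mul_assoc, Matrix.mul_assoc, trace_mul_comm (Matrix.of _)ᴴ]
  generalize ((1 : Matrix A A ℂ) ⊗ₖ C) * X = K at key ⊢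
  simp only [trace, diag_apply, mul_apply,
    conjTranspose_apply, of_apply, transpose_apply, Fintype.sum_prod_type, key]
  refine Finset.sum_congr rfl fun i _ => Finset.sum_congr rfl fun a _ =>
    Finset.sum_congr rfl fun e _ => ?_
  rw [mul_comm]
  congr 1
  exact Finset.sum_congr rfl fun e' _ => mul_comm _ _

lemma trace_coefficient_mul_conjTranspose {Q R : Type*} [Fintype Q] [Fintype R] [DecidableEq Q]
    {V : Matrix (A × p) Q ℂ} (hV : Vᴴ * V = 1) (S : Matrix Q R ℂ) :
    ((Matrix.of fun (x : R × A) e => (V * S) (x.2, e) x.1) *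
      (Matrix.of fun (x : R × A) e => (V * S) (x.2, e) x.1)ᴴ).trace =
    (vecMulVec (fun x : R × Q => S x.2 x.1) (star fun x : R × Q => S x.2 x.1)).trace := by
  rw [← onRight_traceRight_conj_vecMulVec, trace_onRight]
  exact (isChannel_traceRight.comp (isChannel_conj hV)).tracePreserving

/-- Continuity of the Stinespring dilation: dilations of channels that are close in diamond norm
are close up to a contraction of the environment. -/
theorem exists_contraction_of_diamondDist_le {V : Matrix (A × p) (Fin k) ℂ}
    {W : Matrix (A × q) (Fin k) ℂ} (hV : Vᴴ * V = 1) (hW : Wᴴ * W = 1) {δ : ℝ}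
    (h : diamondDist (traceRight ∘ₗ conj V) (traceRight ∘ₗ conj W) ≤ (δ : EReal)) :
    ∃ C : Matrix q p ℂ, IsContraction C ∧ ∀ ρ, IsDensity ρ →
      1 - δ / 2 ≤ (ρ * (Wᴴ * ((1 : Matrix A A ℂ) ⊗ₖ C) * V)).trace.re := by
  let L : Matrix q p ℂ →ₗ[ℂ] Op (Fin k) :=
    { toFun := fun C => Wᴴ * ((1 : Matrix A A ℂ) ⊗ₖ C) * V
      map_add' := fun C D => by rw [kronecker_add, Matrix.mul_add, Matrix.add_mul]
      map_smul' := fun c C => by simp [kronecker_smul] }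
  -- The overlap is linear in `C`, so by minimax it suffices to find a contraction for each state
  -- separately.
  refine exists_contraction_forall_density L _ fun ρ hρ => ?_
  obtain ⟨S, rfl⟩ := hρ.posSemidef.exists_conjTranspose_mul_self
  -- `ψ` purifies `ρ = S† S`, with a reference system of the same dimension as the input.
  set ψ : Fin k × Fin k → ℂ := fun x => Sᴴ x.2 x.1
  have hψ : IsDensity (vecMulVec ψ (star ψ)) := by
    refine ⟨posSemidef_vecMulVec_self_star ψ, ?_⟩
    rw [← hρ.trace_eq_one]
    simp only [trace, diag_apply, vecMulVec_apply, mul_apply, Fintype.sum_prod_type_right, ψ,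
      conjTranspose_apply, Pi.star_apply, star_star]
  have hle := le_diamondDist h hψ
  rw [onRight_traceRight_conj_vecMulVec, onRight_traceRight_conj_vecMulVec] at hle
  obtain ⟨C, hC, hCt⟩ := exists_contraction_re_trace _ _
    ((trace_coefficient_mul_conjTranspose hV Sᴴ).trans hψ.trace_eq_one)
    ((trace_coefficient_mul_conjTranspose hW Sᴴ).trans hψ.trace_eq_one)
  refine ⟨C, hC, le_trans (by linarith) (hCt.trans (le_of_eq ?_))⟩
  rw [← trace_conjTranspose_mul_kronecker_mul]
  congr 1
  rw [conjTranspose_mul, conjTranspose_conjTranspose, Matrix.mul_assoc Sᴴ, trace_mul_comm Sᴴ]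
  simp only [L, LinearMap.coe_mk, AddHom.coe_mk, Matrix.mul_assoc]

end Continuity

/-! ### From overlaps of isometries to diamond distance. -/

section DiamondDistance

variable {Q Y Z B : Type*} [Fintype Q] [Fintype Y] [Fintype Z] [Fintype B]
  [DecidableEq Q] [DecidableEq Y] [DecidableEq Z] [DecidableEq B]

/-- Both parts of the Jordan decomposition stay positive and keep their traces. -/
lemma IsChannel.traceNorm_onRight_le {R : Type*} [Fintype R] [DecidableEq R] {Φ : SuperOp Z B}
    (h : IsChannel Φ) {X : Op (R × Z)} (hX : X.IsHermitian) :
    traceNorm (onRight R Φ X) ≤ traceNorm X := by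
  obtain ⟨A, C, hA, hC, rfl, htr⟩ := hX.exists_jordan
  rw [map_sub]
  refine (traceNorm_sub_le _ _).trans (le_trans (add_le_add
    (traceNorm_le_of_posSemidef (h.posSemidef_onRight hA))
    (traceNorm_le_of_posSemidef (h.posSemidef_onRight hC))) ?_)
  rwa [trace_onRight h.tracePreserving, trace_onRight h.tracePreserving]

lemma traceNorm_conj_sub_conj_le {V W : Matrix Z Y ℂ} (hV : Vᴴ * V = 1) (hW : Wᴴ * W = 1)
    {ρ : Op Y} (hρ : IsDensity ρ) {δ : ℝ} (h : 1 - δ / 2 ≤ (ρ * (Wᴴ * V)).trace.re) :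
    traceNorm (V * ρ * Vᴴ - W * ρ * Wᴴ) ≤ 2 * √δ := by
  obtain ⟨T, hT⟩ := hρ.posSemidef.exists_conjTranspose_mul_self
  obtain ⟨S, rfl⟩ : ∃ S : Matrix Y Y ℂ, ρ = S * Sᴴ := ⟨Tᴴ, by rw [conjTranspose_conjTranspose, hT]⟩
  have hone : ∀ {U : Matrix Z Y ℂ}, Uᴴ * U = 1 → ((U * S)ᴴ * (U * S)).trace = 1 := by
    intro U hU
    rw [conjTranspose_mul, Matrix.mul_assoc, ← Matrix.mul_assoc Uᴴ, hU, Matrix.one_mul,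
      trace_mul_comm, hρ.trace_eq_one]
  have hVS := hone hV
  have hWS := hone hW
  have hcross : (S * Sᴴ * (Wᴴ * V)).trace = ((W * S)ᴴ * (V * S)).trace := by
    rw [conjTranspose_mul, Matrix.mul_assoc S, trace_mul_comm S]
    simp only [Matrix.mul_assoc]
  rw [hcross] at h
  set a := V * S
  set b := W * S
  have hab : ((a - b)ᴴ * (a - b)).trace.re ≤ δ := by
    have hconj : (aᴴ * b).trace.re = (bᴴ * a).trace.re := by
      have : aᴴ * b = (bᴴ * a)ᴴ := by rw [conjTranspose_mul bᴴ, conjTranspose_conjTranspose]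
      rw [this, trace_conjTranspose]
      exact Complex.conj_re _
    rw [conjTranspose_sub, Matrix.sub_mul, Matrix.mul_sub, Matrix.mul_sub, trace_sub, trace_sub,
      trace_sub, hVS, hWS]
    simp only [Complex.sub_re, Complex.one_re, hconj]
    linarith
  -- The difference telescopes. By Cauchy-Schwarz each term contributes `√δ`, as `a`, `b` are
  -- Hilbert-Schmidt unit vectors at squared distance at most `δ`.
  have e : V * (S * Sᴴ) * Vᴴ - W * (S * Sᴴ) * Wᴴ = (a - b) * aᴴ + b * (a - b)ᴴ := by
    simp only [a, b, conjTranspose_sub, conjTranspose_mul, Matrix.sub_mul, Matrix.mul_sub,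
      Matrix.mul_assoc]
    abel
  rw [e]
  refine traceNorm_le_of_forall fun H hH => ?_
  rw [Matrix.mul_add, trace_add, two_mul, ← Matrix.mul_assoc, ← Matrix.mul_assoc,
    trace_mul_comm _ aᴴ, trace_mul_comm _ (a - b)ᴴ]
  refine (norm_add_le _ _).trans (add_le_add ?_ ?_)
  · refine (norm_trace_conjTranspose_mul_le _ _).trans ?_
    rw [hVS, Complex.one_re, Real.sqrt_one, one_mul]
    exact Real.sqrt_le_sqrt ((hH.re_trace_le _).trans hab)
  · refine (norm_trace_conjTranspose_mul_le _ _).trans ?_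
    calc _ ≤ √δ * √(bᴴ * b).trace.re := by
          refine mul_le_mul (Real.sqrt_le_sqrt hab) (Real.sqrt_le_sqrt (hH.re_trace_le b))
            (Real.sqrt_nonneg _) (Real.sqrt_nonneg _)
      _ = √δ := by rw [hWS, Complex.one_re, Real.sqrt_one, mul_one]

/-- Only the marginal on `Q` enters the overlap, so a bound for states of `Q` also covers inputs
entangled with an ancilla. -/
lemma trace_mul_one_kronecker {R : Type*} [Fintype R] [DecidableEq R] (ρ : Op (R × Q))
    (M : Op Q) : (ρ * ((1 : Matrix R R ℂ) ⊗ₖ M)).trace = (traceLeft ρ * M).trace := by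
  simp only [trace, diag_apply, mul_apply, Fintype.sum_prod_type, kroneckerMap_apply, one_apply,
    traceLeft, LinearMap.coe_mk, AddHom.coe_mk, of_apply, ite_mul, one_mul, zero_mul, mul_ite,
    mul_zero, Finset.sum_mul]
  rw [Finset.sum_comm]
  refine Finset.sum_congr rfl fun i _ => ?_
  conv_rhs => rw [Finset.sum_comm]
  refine Finset.sum_congr rfl fun r _ => ?_
  rw [Finset.sum_comm]
  simp

lemma diamondDist_comm (Φ Ψ : SuperOp Q B) : diamondDist Φ Ψ = diamondDist Ψ Φ := by
  unfold diamondDist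
  refine iSup_congr fun d => iSup_congr fun ρ => iSup_congr fun _ => ?_
  rw [← traceNorm_neg, neg_sub]

lemma diamondDist_le_two {Φ Ψ : SuperOp Q B} (hΦ : IsChannel Φ) (hΨ : IsChannel Ψ) :
    diamondDist Φ Ψ ≤ ((2 : ℝ) : EReal) := by
  refine iSup_le fun d => iSup₂_le fun ρ hρ => EReal.coe_le_coe_iff.2 ?_
  refine (traceNorm_sub_le _ _).trans (le_trans (add_le_add
    (traceNorm_le_of_posSemidef (hΦ.posSemidef_onRight hρ.posSemidef))
    (traceNorm_le_of_posSemidef (hΨ.posSemidef_onRight hρ.posSemidef))) ?_)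
  rw [trace_onRight hΦ.tracePreserving, trace_onRight hΨ.tracePreserving, hρ.trace_eq_one]
  norm_num

/-- Channels with nearby Stinespring dilations are close in diamond norm. -/
theorem diamondDist_comp_conj_le {Λ : SuperOp Z B} (hΛ : IsChannel Λ) {V W : Matrix Z Q ℂ}
    (hV : Vᴴ * V = 1) (hW : Wᴴ * W = 1) {δ : ℝ}
    (h : ∀ ρ, IsDensity ρ → 1 - δ / 2 ≤ (ρ * (Wᴴ * V)).trace.re) :
    diamondDist (Λ ∘ₗ conj V) (Λ ∘ₗ conj W) ≤ ((2 * √δ : ℝ) : EReal) := by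
  refine iSup_le fun d => iSup₂_le fun ρ hρ => EReal.coe_le_coe_iff.2 ?_
  have hiso : ∀ {U : Matrix Z Q ℂ}, Uᴴ * U = 1 →
      ((1 : Matrix (Fin d) (Fin d) ℂ) ⊗ₖ U)ᴴ * ((1 : Matrix (Fin d) (Fin d) ℂ) ⊗ₖ U) = 1 := by
    intro U hU
    rw [conjTranspose_kronecker, ← mul_kronecker_mul, hU, conjTranspose_one, Matrix.one_mul,
      one_kronecker_one]
  have hle := traceNorm_conj_sub_conj_le (hiso hV) (hiso hW) hρ (δ := δ) (by
    rw [conjTranspose_kronecker, ← mul_kronecker_mul, conjTranspose_one, Matrix.one_mul,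
      trace_mul_one_kronecker]
    exact h _ (isChannel_traceLeft.isDensity hρ))
  rw [onRight_comp, onRight_comp, LinearMap.comp_apply, LinearMap.comp_apply, ← map_sub,
    onRight_conj, onRight_conj]
  refine (hΛ.traceNorm_onRight_le ?_).trans hle
  exact (hρ.posSemidef.mul_mul_conjTranspose_same _).1.sub
    (hρ.posSemidef.mul_mul_conjTranspose_same _).1

end DiamondDistance

/-! ### Recovery from `M'` versus independence of `M`. -/

section Complementary

variable {M M' : Type*} [Fintype M] [Fintype M'] [DecidableEq M] [DecidableEq M'] {k : ℕ}

lemma reindex_comp_conj {A B C : Type*} [Fintype A] [Fintype B] [Fintype C] (e : B ≃ C)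
    (V : Matrix B A ℂ) :
    (Matrix.reindexLinearEquiv ℂ ℂ e e).toLinearMap ∘ₗ conj V = conj (V.submatrix e.symm id) :=
  rfl

lemma exists_isDensity (hk : 0 < k) : ∃ ρ : Op (Fin k), IsDensity ρ := by
  refine ⟨diagonal (Pi.single ⟨0, hk⟩ 1), PosSemidef.diagonal ?_, ?_⟩
  · exact Pi.single_nonneg.2 zero_le_one
  · simp [trace_diagonal]

/-- If the input can be recovered from `M'`, then `M` is close to independent of the input. -/
theorem exists_discardPrepare_of_decoder (hk : 0 < k) {N : SuperOp (Fin k) (M × M')}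
    (hN : IsChannel N) {D : SuperOp M' (Fin k)} (hD : IsChannel D) {ε : ℝ}
    (h : diamondDist (D ∘ₗ traceLeft ∘ₗ N) LinearMap.id ≤ (ε : EReal)) :
    ∃ σ : Op M, IsDensity σ ∧
      diamondDist (discardPrepare σ) (traceRight ∘ₗ N) ≤ ((2 * √ε : ℝ) : EReal) := by
  obtain ⟨ρ₀, hρ₀⟩ := exists_isDensity hk
  have hNM : IsChannel (traceRight ∘ₗ N) := isChannel_traceRight.comp hN
  -- For `ε ≥ 2` the bound is at least the trivial one. Otherwise `1 - ε/2 > 0`, which keeps the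
  -- contraction below from vanishing.
  rcases le_or_gt 2 ε with hε | hε
  · have hσ := hNM.isDensity hρ₀
    refine ⟨_, hσ, (diamondDist_le_two (isChannel_discardPrepare hσ) hNM).trans
      (EReal.coe_le_coe_iff.2 ?_)⟩
    have : (1 : ℝ) ≤ √ε := Real.one_le_sqrt.2 (by linarith)
    linarith
  let G := Fin k × (M × Fin k)
  have hΨ : IsChannel (onRight M D ∘ₗ N) := (isChannel_onRight M hD).comp hN
  obtain ⟨U, hU, hΨU⟩ := hΨ.exists_stinespring (Equiv.refl G)
  -- Regrouping makes the decoded `Q` the output and places `M` in the environment, so one isometry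
  -- dilates the decoded channel and still determines the marginal on `M`.
  let e : (M × Fin k) × G ≃ Fin k × (M × G) :=
    ((Equiv.prodComm _ _).prodCongr (Equiv.refl G)).trans (Equiv.prodAssoc _ _ _)
  set V : Matrix (Fin k × (M × G)) (Fin k) ℂ := U.submatrix e.symm id with hVdef
  have hV : Vᴴ * V = 1 := by
    rw [hVdef, conjTranspose_submatrix, submatrix_mul_equiv, hU]
    exact submatrix_id_id _
  have hVQ : traceRight ∘ₗ conj V = D ∘ₗ traceLeft ∘ₗ N := by
    rw [← LinearMap.comp_assoc, ← traceLeft_comp_onRight, LinearMap.comp_assoc, hΨU]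
    refine LinearMap.ext fun X => Matrix.ext fun q q' => ?_
    exact Fintype.sum_prod_type _
  have hVM : (traceRight ∘ₗ traceLeft) ∘ₗ conj V = traceRight ∘ₗ N := by
    rw [← traceRight_comp_onRight hD, LinearMap.comp_assoc N, hΨU]
    refine LinearMap.ext fun X => Matrix.ext fun m m' => ?_
    simp only [LinearMap.comp_apply, traceRight, traceLeft, LinearMap.coe_mk, AddHom.coe_mk,
      of_apply]
    rw [Finset.sum_comm]
    rfl
  -- The identity channel is dilated with a one-dimensional environment, so the contraction obtained
  -- from continuity is a single row.
  set J : Matrix (Fin k × Unit) (Fin k) ℂ := (1 : Matrix (Fin k) (Fin k) ℂ).submatrix Prod.fst id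
    with hJdef
  have hJX : ∀ X, conj J X = X.submatrix Prod.fst Prod.fst := by
    intro X
    rw [conj_apply, hJdef, conjTranspose_submatrix, conjTranspose_one]
    have : X = X.submatrix id id := rfl
    conv_lhs => rw [this]
    rw [← submatrix_mul _ _ _ _ _ Function.bijective_id,
      ← submatrix_mul _ _ _ _ _ Function.bijective_id, Matrix.one_mul, Matrix.mul_one]
  have hJ1 : traceRight ∘ₗ conj J = LinearMap.id := by
    refine LinearMap.ext fun X => ?_
    rw [LinearMap.comp_apply, hJX]
    ext q q'
    simp [traceRight]
  have hJ : Jᴴ * J = 1 := by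
    rw [hJdef, conjTranspose_submatrix, conjTranspose_one]
    ext i j
    rw [mul_apply, Fintype.sum_prod_type]
    simp only [one_apply, submatrix_apply, id_eq, Finset.univ_unique, Finset.sum_singleton,
      mul_ite, mul_one, mul_zero, Finset.sum_ite_eq', Finset.mem_univ, if_true]
  rw [← hVQ, ← hJ1] at h
  obtain ⟨C, hC, hCρ⟩ := exists_contraction_of_diamondDist_le hV hJ h
  -- The row has squared norm `r` with `0 < r ≤ 1`. Rescaling it to a unit vector multiplies a
  -- positive overlap by a factor of at least one.
  obtain ⟨C', hC', hCρ'⟩ : ∃ C' : Matrix Unit (M × G) ℂ, C' * C'ᴴ = 1 ∧ ∀ ρ, IsDensity ρ →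
      1 - ε / 2 ≤ (ρ * (Jᴴ * ((1 : Matrix (Fin k) (Fin k) ℂ) ⊗ₖ C') * V)).trace.re := by
    set r := ((C * Cᴴ) () ()).re with hr
    have hCC : C * Cᴴ = (r : ℂ) • (1 : Op Unit) := by
      have hi := congrFun (congrFun (isHermitian_mul_conjTranspose_self C).eq ()) ()
      ext i j
      simpa using (Complex.conj_eq_iff_re.1 hi).symm
    have hr1 : r ≤ 1 := by
      have := (Complex.le_def.1 (PosSemidef.diag_nonneg
        (show (1 - Cᴴᴴ * Cᴴ).PosSemidef from hC.conjTranspose) (i := ()))).1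
      rw [conjTranspose_conjTranspose] at this
      simpa using this
    have hr0 : 0 < r := by
      refine lt_of_le_of_ne ?_ fun h0 => ?_
      · exact (Complex.le_def.1 (PosSemidef.diag_nonneg
          (posSemidef_self_mul_conjTranspose C) (i := ()))).1
      · rw [← h0, Complex.ofReal_zero, zero_smul, self_mul_conjTranspose_eq_zero] at hCC
        have := hCρ ρ₀ hρ₀
        simp only [hCC, kronecker_zero, Matrix.mul_zero, Matrix.zero_mul, trace_zero,
          Complex.zero_re] at this
        linarith
    refine ⟨(((√r)⁻¹ : ℝ) : ℂ) • C, ?_, fun ρ hρ => ?_⟩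
    · rw [conjTranspose_smul, Matrix.smul_mul, Matrix.mul_smul, hCC, smul_smul, smul_smul]
      have : (√r)⁻¹ * ((√r)⁻¹ * r) = 1 := by
        have h1 : √r ≠ 0 := (Real.sqrt_pos.2 hr0).ne'
        field_simp
        exact (Real.sq_sqrt hr0.le).symm
      have : (((√r)⁻¹ : ℝ) : ℂ) * (star (((√r)⁻¹ : ℝ) : ℂ) * (r : ℂ)) = 1 := by
        rw [RCLike.star_def, Complex.conj_ofReal]
        exact_mod_cast this
      rw [mul_assoc, this, one_smul]
    · have hc := hCρ ρ hρ
      rw [kronecker_smul, Matrix.mul_smul, Matrix.smul_mul, Matrix.mul_smul, trace_smul,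
        smul_eq_mul, Complex.re_ofReal_mul]
      refine hc.trans (le_mul_of_one_le_left (by linarith) ?_)
      exact (one_le_inv₀ (Real.sqrt_pos.2 hr0)).2 (Real.sqrt_le_one.2 hr1)
  -- `W` sets the fixed pure state `C'† C'` beside the input; its marginal on `M` is the simulator's
  -- state.
  set W : Matrix (Fin k × (M × G)) (Fin k) ℂ := ((1 : Matrix (Fin k) (Fin k) ℂ) ⊗ₖ C'ᴴ) * J
  have hWh : Wᴴ = Jᴴ * ((1 : Matrix (Fin k) (Fin k) ℂ) ⊗ₖ C') := by
    rw [conjTranspose_mul, conjTranspose_kronecker, conjTranspose_one, conjTranspose_conjTranspose]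
  have hW : Wᴴ * W = 1 := by
    rw [hWh, Matrix.mul_assoc, ← Matrix.mul_assoc (_ ⊗ₖ _), ← mul_kronecker_mul, hC',
      Matrix.one_mul, one_kronecker_one, Matrix.one_mul, hJ]
  have hτ : IsDensity (C'ᴴ * C') := by
    refine ⟨posSemidef_conjTranspose_mul_self _, ?_⟩
    rw [trace_mul_comm, hC']
    simp
  refine ⟨traceRight (C'ᴴ * C'), isChannel_traceRight.isDensity hτ, ?_⟩
  have hWM : (traceRight ∘ₗ traceLeft) ∘ₗ conj W = discardPrepare (traceRight (C'ᴴ * C')) := by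
    rw [← conj_comp, LinearMap.comp_assoc, ← LinearMap.comp_assoc (conj J),
      traceLeft_comp_conj_kronecker]
    refine LinearMap.ext fun X => ?_
    have : traceLeft (conj J X) = X.trace • (1 : Op Unit) := by
      rw [hJX]
      ext i j
      simp [traceLeft, trace]
    simp only [LinearMap.comp_apply, this, map_smul]
    simp [conj_apply, discardPrepare]
  rw [diamondDist_comm, ← hVM, ← hWM]
  exact diamondDist_comp_conj_le (isChannel_traceRight.comp isChannel_traceLeft) hV hW
    (fun ρ hρ => by rw [hWh]; exact hCρ' ρ hρ)

/-- Discard the second summand, preparing `τ` instead, and then the first factor of the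
first summand. -/
def decodeSum {G H Q : Type*} [Fintype G] [Fintype H] (τ : Op Q) :
    SuperOp ((G × Q) ⊕ H) Q where
  toFun X := traceLeft X.toBlocks₁₁ + discardPrepare τ X.toBlocks₂₂
  map_add' X Y := by
    have h1 : (X + Y).toBlocks₁₁ = X.toBlocks₁₁ + Y.toBlocks₁₁ := rfl
    have h2 : (X + Y).toBlocks₂₂ = X.toBlocks₂₂ + Y.toBlocks₂₂ := rfl
    rw [h1, h2, map_add, map_add, add_add_add_comm]
  map_smul' c X := by
    have h1 : (c • X).toBlocks₁₁ = c • X.toBlocks₁₁ := rfl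
    have h2 : (c • X).toBlocks₂₂ = c • X.toBlocks₂₂ := rfl
    rw [h1, h2, map_smul, map_smul, smul_add]
    rfl

lemma isChannel_decodeSum {G H Q : Type*} [Fintype G] [Fintype H] [Fintype Q] {τ : Op Q}
    (hτ : IsDensity τ) : IsChannel (decodeSum τ : SuperOp ((G × Q) ⊕ H) Q) where
  completelyPositive k X hX := by
    have h1 := isChannel_traceLeft.completelyPositive k _ (hX.submatrix
      (Prod.map id Sum.inl : Fin k × (G × Q) → Fin k × ((G × Q) ⊕ H)))
    have h2 := (isChannel_discardPrepare hτ).completelyPositive k _ (hX.submatrix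
      (Prod.map id Sum.inr : Fin k × H → Fin k × ((G × Q) ⊕ H)))
    have := h1.add h2
    convert this using 1
    refine Matrix.ext fun p q => ?_
    simp only [onRight_apply, decodeSum, LinearMap.coe_mk, AddHom.coe_mk, Matrix.add_apply]
    rfl
  tracePreserving X := by
    have h : (decodeSum τ X).trace =
        (traceLeft X.toBlocks₁₁).trace + (discardPrepare τ X.toBlocks₂₂).trace := trace_add _ _
    rw [h, isChannel_traceLeft.tracePreserving, (isChannel_discardPrepare hτ).tracePreserving]
    simp [trace, Fintype.sum_sum_type, toBlocks₁₁, toBlocks₂₂]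

/-- A dilation of the channel that discards its input and prepares `σ`. -/
lemma exists_dilation_discardPrepare {σ : Op M} (hσ : IsDensity σ) :
    ∃ J : Matrix (M × (M × Fin k)) (Fin k) ℂ, Jᴴ * J = 1 ∧
      traceRight ∘ₗ conj J = discardPrepare σ ∧
      traceLeft ∘ₗ traceLeft ∘ₗ conj J = LinearMap.id := by
  obtain ⟨T, hT⟩ := hσ.posSemidef.exists_conjTranspose_mul_self
  -- `J` appends a purification of `σ`; the environment holds the purifying copy of `M` and the
  -- untouched input.
  let J : Matrix (M × (M × Fin k)) (Fin k) ℂ :=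
    Matrix.of fun x q => star (T x.2.1 x.1) * (1 : Matrix (Fin k) (Fin k) ℂ) x.2.2 q
  have hJX : ∀ X x y, conj J X x y =
      star (T x.2.1 x.1) * T y.2.1 y.1 * X x.2.2 y.2.2 := by
    intro X x y
    simp only [conj_apply, mul_apply, J, one_apply, of_apply, conjTranspose_apply, mul_ite,
      mul_one, mul_zero, ite_mul, zero_mul, Finset.sum_ite_eq, Finset.mem_univ, if_true,
      apply_ite star, star_star, star_zero]
    ring
  have hJM : traceRight ∘ₗ conj J = discardPrepare σ := by
    refine LinearMap.ext fun X => Matrix.ext fun m m' => ?_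
    simp only [LinearMap.comp_apply, traceRight, LinearMap.coe_mk, AddHom.coe_mk, of_apply, hJX,
      discardPrepare, Matrix.smul_apply, hT, mul_apply, conjTranspose_apply, smul_eq_mul, trace,
      diag_apply, Fintype.sum_prod_type, Finset.sum_mul_sum, mul_comm (∑ i, X i i)]
  refine ⟨J, conjTranspose_mul_self_of_tracePreserving fun X => ?_, hJM, ?_⟩
  · rw [← isChannel_traceRight.tracePreserving (conj J X), ← LinearMap.comp_apply, hJM]
    exact (isChannel_discardPrepare hσ).tracePreserving X
  · refine LinearMap.ext fun X => Matrix.ext fun q q' => ?_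
    have htr := hσ.trace_eq_one
    simp only [hT, trace, diag_apply, mul_apply, conjTranspose_apply] at htr
    rw [Finset.sum_comm] at htr
    simp only [LinearMap.comp_apply, traceLeft, LinearMap.coe_mk, AddHom.coe_mk, of_apply, hJX,
      ← Finset.sum_mul]
    rw [htr, one_mul, LinearMap.id_apply]

lemma isometry_one_kronecker_mul {A B Q : Type*} [Fintype A] [Fintype B] [Fintype Q]
    [DecidableEq A] [DecidableEq Q] {L : Matrix B A ℂ} {N : Matrix (M × A) Q ℂ}
    (hL : Lᴴ * L = 1) (hN : Nᴴ * N = 1) :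
    (((1 : Matrix M M ℂ) ⊗ₖ L) * N)ᴴ * (((1 : Matrix M M ℂ) ⊗ₖ L) * N) = 1 := by
  have h : ((1 : Matrix M M ℂ) ⊗ₖ L)ᴴ * ((1 : Matrix M M ℂ) ⊗ₖ L) = 1 := by
    rw [conjTranspose_kronecker, ← mul_kronecker_mul, hL, conjTranspose_one, Matrix.one_mul,
      one_kronecker_one]
  generalize (1 : Matrix M M ℂ) ⊗ₖ L = E at h ⊢
  rw [conjTranspose_mul, Matrix.mul_assoc, ← Matrix.mul_assoc Eᴴ, h, Matrix.one_mul, hN]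

lemma comp_traceLeft_comp_conj_kronecker {A B C Q : Type*} [Fintype A] [Fintype B] [Fintype Q]
    (Φ : SuperOp B C) (L : Matrix B A ℂ) (N : Matrix (M × A) Q ℂ) :
    (Φ ∘ₗ traceLeft) ∘ₗ conj (((1 : Matrix M M ℂ) ⊗ₖ L) * N) =
      (Φ ∘ₗ conj L) ∘ₗ traceLeft ∘ₗ conj N := by
  rw [← conj_comp, ← LinearMap.comp_assoc, LinearMap.comp_assoc _ traceLeft,
    traceLeft_comp_conj_kronecker]
  rfl

/-- If `M` is close to independent of the input, then the input can be recovered from the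
complementary system `M'`. -/
theorem exists_decoder_of_discardPrepare (hk : 0 < k) {V : Matrix (M × M') (Fin k) ℂ}
    (hV : Vᴴ * V = 1) {σ : Op M} (hσ : IsDensity σ) {δ : ℝ}
    (h : diamondDist (discardPrepare σ) (traceRight ∘ₗ conj V) ≤ (δ : EReal)) :
    ∃ D : SuperOp M' (Fin k), IsChannel D ∧
      diamondDist (D ∘ₗ traceLeft ∘ₗ conj V) LinearMap.id ≤ ((2 * √δ : ℝ) : EReal) := by
  obtain ⟨τ, hτ⟩ := exists_isDensity hk
  obtain ⟨J, hJ, hJM, hJQ⟩ := exists_dilation_discardPrepare (k := k) hσ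
  rw [diamondDist_comm, ← hJM] at h
  obtain ⟨C, hC, hCρ⟩ := exists_contraction_of_diamondDist_le hV hJ h
  -- The defect `K` completes the contraction `C` to an isometry `F` into a direct sum. `I` embeds
  -- the first summand, and `I† F = C` preserves the overlap.
  obtain ⟨K, hK⟩ := PosSemidef.exists_conjTranspose_mul_self
    (show (1 - Cᴴ * C).PosSemidef from hC)
  let F : Matrix ((M × Fin k) ⊕ M') M' ℂ := fromRows C K
  let I : Matrix ((M × Fin k) ⊕ M') (M × Fin k) ℂ := fromRows 1 0
  have hF : Fᴴ * F = 1 := by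
    rw [conjTranspose_fromRows_eq_fromCols_conjTranspose, fromCols_mul_fromRows, ← hK]
    abel
  have hI : Iᴴ * I = 1 := by
    rw [conjTranspose_fromRows_eq_fromCols_conjTranspose, fromCols_mul_fromRows]
    simp
  have hIF : Iᴴ * F = C := by
    rw [conjTranspose_fromRows_eq_fromCols_conjTranspose, fromCols_mul_fromRows]
    simp
  have hΛ : IsChannel (decodeSum τ : SuperOp ((M × Fin k) ⊕ M') (Fin k)) :=
    isChannel_decodeSum hτ
  refine ⟨decodeSum τ ∘ₗ conj F, hΛ.comp (isChannel_conj hF), ?_⟩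
  have hdec : decodeSum τ ∘ₗ conj I = traceLeft := by
    refine LinearMap.ext fun X => ?_
    have h1 : (conj I X) = fromBlocks X 0 0 0 := by
      rw [conj_apply, conjTranspose_fromRows_eq_fromCols_conjTranspose, fromRows_mul,
        fromRows_mul_fromCols]
      simp
    rw [LinearMap.comp_apply, h1]
    simp [decodeSum]
  have hJD : (decodeSum τ ∘ₗ conj I) ∘ₗ traceLeft ∘ₗ conj J = LinearMap.id := by
    rw [hdec, hJQ]
  rw [← hJD, ← comp_traceLeft_comp_conj_kronecker, ← comp_traceLeft_comp_conj_kronecker]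
  refine diamondDist_comp_conj_le (hΛ.comp isChannel_traceLeft)
    (isometry_one_kronecker_mul hF hV) (isometry_one_kronecker_mul hI hJ) fun ρ hρ => ?_
  have e : ((1 : Matrix M M ℂ) ⊗ₖ I)ᴴ * ((1 : Matrix M M ℂ) ⊗ₖ F) =
      (1 : Matrix M M ℂ) ⊗ₖ C := by
    rw [conjTranspose_kronecker, ← mul_kronecker_mul, hIF, conjTranspose_one, Matrix.one_mul]
  rw [conjTranspose_mul, Matrix.mul_assoc (Jᴴ), ← Matrix.mul_assoc (_ᴴ) (_ ⊗ₖ _), e,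
    ← Matrix.mul_assoc (Jᴴ)]
  exact hCρ ρ hρ

end Complementary

/-! ### Conversion of protocols and qubit counts. -/

section Protocols

/-- The CDQS protocol in which the referee receives the systems `M₀` and `M₁` of the `f`-routing
protocol `P`, the other systems being discarded. -/
def RoutingProtocol.toCDQS {n dQ : ℕ} (P : RoutingProtocol n dQ) : CDQSProtocol n dQ where
  resource := P.resource
  dM0 := P.dM0
  dM1 := P.dM1
  alice x := traceRight ∘ₗ P.alice x
  bob y := traceRight ∘ₗ P.bob y
  alice_isChannel x := isChannel_traceRight.comp (P.alice_isChannel x)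
  bob_isChannel y := isChannel_traceRight.comp (P.bob_isChannel y)

lemma RoutingProtocol.toCDQS_action {n dQ : ℕ} (P : RoutingProtocol n dQ) (x y : Fin n → Bool) :
    P.toCDQS.action x y = traceRight ∘ₗ P.action x y := by
  rw [CDQSProtocol.action, RoutingProtocol.action]
  simp only [← LinearMap.comp_assoc]
  congr 1
  rw [LinearMap.comp_assoc]
  exact (traceRight_comp_reindex_tensorMap _ _).symm

lemma RoutingProtocol.isChannel_action {n dQ : ℕ} (P : RoutingProtocol n dQ)
    (x y : Fin n → Bool) : IsChannel (P.action x y) :=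
  (isChannel_reindex _).comp ((isChannel_tensorMap (P.alice_isChannel x) (P.bob_isChannel y)).comp
    (isChannel_attach P.resource.isDensity))

lemma tensorMap_conj {A B C D : Type*} [Fintype A] [Fintype B] [Fintype C] [Fintype D]
    [DecidableEq A] [DecidableEq D] (V : Matrix C A ℂ) (W : Matrix D B ℂ) :
    tensorMap (conj V) (conj W) = conj (V ⊗ₖ W) := by
  have h1 : onLeft D (conj V) = conj (V ⊗ₖ (1 : Matrix D D ℂ)) := by
    refine LinearMap.ext fun X => Matrix.ext fun p q => ?_
    simp [onLeft_apply, conj_apply, mul_apply, Fintype.sum_prod_type, one_apply,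
      apply_ite (starRingEnd ℂ), Finset.sum_mul]
  have h2 : onRight A (conj W) = conj ((1 : Matrix A A ℂ) ⊗ₖ W) :=
    LinearMap.ext fun X => onRight_conj A W X
  rw [tensorMap, h1, h2, conj_comp, ← mul_kronecker_mul, Matrix.mul_one, Matrix.one_mul]

lemma attach_vecMulVec {Q L R : Type*} [Fintype Q] [DecidableEq Q] (ψ : L × R → ℂ) :
    (attach (vecMulVec ψ (star ψ)) : SuperOp Q ((Q × L) × R)) =
      conj (Matrix.of fun x q => if x.1.1 = q then ψ (x.1.2, x.2) else 0) := by
  refine LinearMap.ext fun X => Matrix.ext fun p q => ?_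
  simp only [attach, LinearMap.coe_mk, AddHom.coe_mk, of_apply, vecMulVec_apply, Pi.star_apply,
    conj_apply, mul_apply, conjTranspose_apply, ite_mul, zero_mul, Finset.sum_ite_eq,
    Finset.mem_univ, if_true, apply_ite star, star_zero, mul_ite, mul_zero]
  ring

/-- A pure resource and isometric local actions leave nothing outside `M M'`, so `M'` is the full
environment of the channel from `Q` to `M`. -/
lemma RoutingProtocol.exists_action_eq_conj {n dQ : ℕ} (P : RoutingProtocol n dQ)
    (hP : IsPure P.resource.state) {x y : Fin n → Bool}
    {V : Matrix (Fin P.dM0 × Fin P.dM0') (Fin dQ × Fin P.resource.dL) ℂ}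
    {W : Matrix (Fin P.dM1 × Fin P.dM1') (Fin P.resource.dR) ℂ}
    (hV : P.alice x = conj V) (hW : P.bob y = conj W) :
    ∃ U : Matrix ((Fin P.dM0 × Fin P.dM1) × (Fin P.dM0' × Fin P.dM1')) (Fin dQ) ℂ,
      Uᴴ * U = 1 ∧ P.action x y = conj U := by
  obtain ⟨ψ, hψ⟩ := hP
  have h : ∃ U, P.action x y = conj U := by
    rw [RoutingProtocol.action, hV, hW, hψ, tensorMap_conj, attach_vecMulVec, conj_comp,
      reindex_comp_conj]
    exact ⟨_, rfl⟩
  obtain ⟨U, hU⟩ := h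
  exact ⟨U, conjTranspose_mul_self_of_tracePreserving
    (hU ▸ (P.isChannel_action x y).tracePreserving), hU⟩

lemma qubits_mul_le (a b : ℕ) : qubits (a * b) ≤ qubits a + qubits b := by
  refine Nat.clog_le_of_le_pow ?_
  rw [pow_add]
  exact Nat.mul_le_mul (Nat.le_pow_clog one_lt_two a) (Nat.le_pow_clog one_lt_two b)

/-- Unit trace excludes a zero-dimensional share, so neither share needs more qubits than the whole
resource. -/
lemma Resource.nonempty_prod (S : Resource) : Nonempty (Fin S.dL × Fin S.dR) := by
  by_contra h
  have := S.isDensity.trace_eq_one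
  rw [not_nonempty_iff] at h
  simp [trace] at this

lemma Resource.qubits_left_le (S : Resource) : qubits S.dL ≤ S.size := by
  obtain ⟨-, r⟩ := S.nonempty_prod
  exact Nat.clog_mono_right 2 (Nat.le_mul_of_pos_right _ (Fin.pos r))

lemma Resource.qubits_right_le (S : Resource) : qubits S.dR ≤ S.size := by
  obtain ⟨l, -⟩ := S.nonempty_prod
  exact Nat.clog_mono_right 2 (Nat.le_mul_of_pos_left _ (Fin.pos l))

/-- Purifying the two channels of a CDQS protocol gives an `f`-routing protocol. -/
lemma CDQSProtocol.exists_dilation {n dQ : ℕ} (P : CDQSProtocol n dQ) :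
    ∃ P' : RoutingProtocol n dQ, P'.toCDQS = P ∧ P'.dM0' = dQ * P.resource.dL * P.dM0 ∧
      P'.dM1' = P.resource.dR * P.dM1 ∧ (∀ x, ∃ V, P'.alice x = conj V) ∧
      ∀ y, ∃ W, P'.bob y = conj W := by
  obtain ⟨S, a, b, alice, bob, hA, hB⟩ := P
  -- The environment has the dimension of input times output, independent of `x`; this is the source
  -- of the qubit counts.
  choose V hV hVe using fun x => (hA x).exists_stinespring
    ((finProdFinEquiv.symm.trans (finProdFinEquiv.symm.prodCongr (Equiv.refl _))) :
      Fin (dQ * S.dL * a) ≃ (Fin dQ × Fin S.dL) × Fin a)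
  choose W hW hWe using fun y => (hB y).exists_stinespring
    (finProdFinEquiv.symm : Fin (S.dR * b) ≃ Fin S.dR × Fin b)
  refine ⟨⟨S, a, dQ * S.dL * a, b, S.dR * b, fun x => conj (V x), fun y => conj (W y),
    fun x => isChannel_conj (hV x), fun y => isChannel_conj (hW y)⟩, ?_, rfl, rfl,
    fun x => ⟨_, rfl⟩, fun y => ⟨_, rfl⟩⟩
  obtain rfl : alice = fun x => traceRight ∘ₗ conj (V x) := funext hVe
  obtain rfl : bob = fun y => traceRight ∘ₗ conj (W y) := funext hWe
  rfl

end Protocols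

end QuantumRouting

theorem theorem3p3 {n dQ : ℕ} (hQ : 0 < dQ) (f : (Fin n → Bool) → (Fin n → Bool) → Bool) :
    (∀ (ε : ℝ), 0 ≤ ε → ∀ P : QuantumRouting.RoutingProtocol n dQ, P.IsCorrect f ε →
      ∃ P' : QuantumRouting.CDQSProtocol n dQ,
        P'.resource = P.resource ∧ P'.dM0 = P.dM0 ∧ P'.dM1 = P.dM1 ∧
        P'.IsCorrect f ε ∧ P'.IsSecure f (2 * Real.sqrt ε)) ∧
    (∀ (ε δ : ℝ), 0 ≤ ε → 0 ≤ δ → ∀ (nE nM : ℕ) (P : QuantumRouting.CDQSProtocol n dQ),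
      QuantumRouting.IsPure P.resource.state → P.resource.size ≤ nE →
      QuantumRouting.qubits P.dM0 ≤ nM → QuantumRouting.qubits P.dM1 ≤ nM →
      P.IsCorrect f ε → P.IsSecure f δ →
      ∃ P' : QuantumRouting.RoutingProtocol n dQ,
        P'.resource = P.resource ∧
        P'.IsCorrect f (max ε (2 * Real.sqrt δ)) ∧
        P'.exchangedQubits ≤ 4 * (nM + nE) ∧
        P'.totalQubits ≤ 4 * (nM + nE) + QuantumRouting.qubits dQ) := by
  open QuantumRouting in
  refine ⟨fun ε _ P hP => ⟨P.toCDQS, rfl, rfl, rfl, fun x y hxy => ?_, fun x y hxy => ?_⟩,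
    fun ε δ _ _ nE nM P hpure hE hM0 hM1 hcor hsec => ?_⟩
  · obtain ⟨D, hD, h⟩ := hP.1 x y hxy
    exact ⟨D, hD, by rw [P.toCDQS_action]; exact h⟩
  · obtain ⟨D, hD, h⟩ := hP.2 x y hxy
    rw [P.toCDQS_action]
    exact exists_discardPrepare_of_decoder hQ (P.isChannel_action x y) hD h
  -- Discarding the purifying systems returns `P` itself, so its correctness and security apply
  -- without loss.
  · obtain ⟨P', rfl, hd0, hd1, hA, hB⟩ := P.exists_dilation
    refine ⟨P', rfl, ⟨fun x y hxy => ?_, fun x y hxy => ?_⟩, ?_, ?_⟩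
    · obtain ⟨D, hD, h⟩ := hcor x y hxy
      rw [P'.toCDQS_action] at h
      exact ⟨D, hD, h.trans (EReal.coe_le_coe_iff.2 (le_max_left _ _))⟩
    · obtain ⟨σ, hσ, h⟩ := hsec x y hxy
      obtain ⟨V, hV⟩ := hA x
      obtain ⟨W, hW⟩ := hB y
      obtain ⟨U, hU, hact⟩ := P'.exists_action_eq_conj hpure hV hW
      rw [P'.toCDQS_action, hact] at h
      obtain ⟨D, hD, hdist⟩ := exists_decoder_of_discardPrepare hQ hU hσ h
      rw [← hact] at hdist
      exact ⟨D, hD, hdist.trans (EReal.coe_le_coe_iff.2 (le_max_right _ _))⟩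
    -- The exchanged systems need at most `2 nM + nE` qubits, and all four at most `4 nM + 2 nE +
    -- qubits dQ`.
    all_goals
      have h0 := qubits_mul_le (dQ * P'.resource.dL) P'.dM0
      have h1 := qubits_mul_le dQ P'.resource.dL
      have h2 := qubits_mul_le P'.resource.dR P'.dM1
      have h3 := P'.resource.qubits_left_le
      have h4 := P'.resource.qubits_right_le
      change P'.resource.size ≤ nE at hE
      change qubits P'.dM0 ≤ nM at hM0
      change qubits P'.dM1 ≤ nM at hM1
      change P'.dM0' = dQ * P'.resource.dL * P'.dM0 at hd0
      change P'.dM1' = P'.resource.dR * P'.dM1 at hd1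
      simp only [RoutingProtocol.exchangedQubits, RoutingProtocol.totalQubits, hd0, hd1]
      omega
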